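/- Let $\mathcal B^d=\{v\in\mathbb R^d:\|v\|_2\le 1\}$. For a class $C$ of functions $f:X\to\{-1,1\}$ let $\mathrm{mc}(C)$ (the margin complexity) be the infimum of all $M>0$ such that for some $d$ there is a map $\Psi:X\to\mathcal B^d$ with the following property: for every $f\in C$ there is $w\in\mathcal B^d$ with $f(x)\langle w,\Psi(x)\rangle\ge 1/M$ for all $x\in X$. An $\eta$-local randomizer on $Z=X\times\{-1,1\}$ is a randomized map $R:Z\to W$ into a discrete set with $\Pr[R(z_1)=w]\le e^{\eta}\Pr[R(z_2)=w]$ for all $z_1,z_2\in Z$, $w\in W$. A (randomized) algorithm is $\varepsilon$-LDP if it accesses its dataset $(z_1,\dots,z_n)\in Z^n$ only by choosing, possibly adaptively, an index $i$ and an $\eta$-local randomizer $R$, and receiving a sample of $R(z_i)$, where for each $i$ the parameters $\eta$ of all the randomizers applied to $z_i$ sum to at most $\varepsilon$. It is label-non-adaptive if, once its internal randomness is fixed, the queries that are not label-independent are determined before any response is observed (a query is label-independent if the distribution of $R(x,y)$ does not depend on the label $y$); so only label-independent queries may depend on the responses. It PAC learns $C$ distribution-independently with accuracy $1-\alpha$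 if for every $f\in C$ and every probability distribution $D$ on $X$, given $n$ independent examples $(x,f(x))$ with $x\sim D$, it outputs with probability at least $2/3$ a function $h:X\to\{-1,1\}$ with $\Pr_{x\sim D}[f(x)\ne h(x)]\le\alpha$. **Theorem 2.** There is a polynomial $P$ (an absolute one) such that for every domain $X$, every class $C$ of Boolean functions $f:X\to\{-1,1\}$ with $\mathrm{mc}(C)<\infty$, and all $\alpha,\varepsilon>0$, there is a label-non-adaptive $\varepsilon$-LDP algorithm that PAC learns $C$ distribution-independently with accuracy $1-\alpha$ using at most $$P\!\left(\frac{\mathrm{mc}(C)}{\alpha\,\min(\varepsilon,1)}\right)$$ examples. -/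

import Mathlib

open scoped ENNReal

noncomputable section

namespace LDP

/-- The `±1` value of a Boolean label. -/
def sgn (b : Bool) : ℝ := if b then 1 else -1

/-- Some map of `X` into the unit ball of some `ℝ^d` separates every function in `C` with
margin at least `1 / M` (only used for `0 < M`). -/
def SeparableWith {X : Type*} (C : Set (X → Bool)) (M : ℝ) : Prop :=
  ∃ (d : ℕ) (Ψ : X → EuclideanSpace ℝ (Fin d)), (∀ x, ‖Ψ x‖ ≤ 1) ∧
    ∀ f ∈ C, ∃ w : EuclideanSpace ℝ (Fin d), ‖w‖ ≤ 1 ∧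
      ∀ x, 1 / M ≤ sgn (f x) * inner ℝ w (Ψ x)

/-- Margin complexity of a class of Boolean functions (`⊤` if no embedding has positive
margin). -/
def marginComplexity {X : Type*} (C : Set (X → Bool)) : ℝ≥0∞ :=
  ⨅ (M : ℝ) (_ : 0 < M ∧ SeparableWith C M), ENNReal.ofReal M

/-- An `ε`-local randomizer on `Z`, with values in a discrete space `W`:
`Pr[R(z₁) = w] ≤ e^ε Pr[R(z₂) = w]` for all `z₁, z₂, w`. -/
structure LocalRandomizer (Z : Type*) [MeasurableSpace Z] (ε : ℝ) where
  /-- the space of responses -/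
  W : Type
  /-- the distribution of the response on each data point -/
  law : Z → PMF W
  measurable_law : ∀ w, Measurable fun z => law z w
  law_le : ∀ z₁ z₂ w, law z₁ w ≤ ENNReal.ofReal (Real.exp ε) * law z₂ w

/-- One invocation of the local randomizer oracle for a dataset of size `n`: an index and an
`eps`-local randomizer. -/
structure Query (Z : Type*) [MeasurableSpace Z] (n : ℕ) where
  index : Fin n
  eps : ℝ
  eps_nonneg : 0 ≤ eps
  rand : LocalRandomizer Z eps

/-- A deterministic algorithm that accesses a dataset in `Z^n` only through the local randomizer
oracle: a decision tree, in which each query may depend on all earlier responses. -/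
inductive Program (Z : Type*) [MeasurableSpace Z] (n : ℕ) (O : Type*) where
  | output (o : O) : Program Z n O
  | query (q : Query Z n) (next : q.rand.W → Program Z n O) : Program Z n O

namespace Program

/-- The distribution of the output on the dataset `S` (over the randomness of the oracle). -/
def run {Z : Type*} [MeasurableSpace Z] {n : ℕ} {O : Type*} (S : Fin n → Z) :
    Program Z n O → PMF O
  | output o => PMF.pure o
  | query q next => (q.rand.law (S q.index)).bind fun w => run S (next w)

/-- `Asks p L`: for some sequence of responses, `L` is the list of all queries that `p` makes, in
order. -/
inductive Asks {Z : Type*} [MeasurableSpace Z] {n : ℕ} {O : Type*} :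
    Program Z n O → List (Query Z n) → Prop
  | output (o : O) : Asks (Program.output o) []
  | query (q : Query Z n) (next : q.rand.W → Program Z n O) (w : q.rand.W)
      (L : List (Query Z n)) : Asks (next w) L → Asks (Program.query q next) (q :: L)

/-- (Compositional) `ε`-LDP: in every execution and for each index `i`, the privacy parameters of
all the randomizers invoked on `i` sum up to at most `ε`. -/
def IsLDP {Z : Type*} [MeasurableSpace Z] {n : ℕ} {O : Type*} (p : Program Z n O) (ε : ℝ) :
    Prop :=
  ∀ L, p.Asks L → ∀ i : Fin n, ((L.filter fun q => q.index = i).map Query.eps).sum ≤ ε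

end Program

/-- The query depends only on the point, not on its label. -/
def Query.LabelIndependent {X : Type*} [MeasurableSpace X] {n : ℕ} (q : Query (X × Bool) n) :
    Prop :=
  ∀ x y y', q.rand.law (x, y) = q.rand.law (x, y')

open Classical in
/-- All queries that depend on the oracle's responses are label-independent: the sequence of the
queries that are not label-independent is fixed in advance, whatever the responses are. -/
def Program.LabelNonAdaptive {X : Type*} [MeasurableSpace X] {n : ℕ} {O : Type*}
    (p : Program (X × Bool) n O) : Prop :=
  ∃ L₀ : List (Query (X × Bool) n), ∀ L, p.Asks L →
    (L.filter fun q => ¬ q.LabelIndependent) = L₀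

/-- A randomized learning algorithm using `n` examples: it draws its internal randomness, that is
a deterministic program, which then interacts with the oracle and outputs a hypothesis. -/
abbrev Learner (X : Type*) [MeasurableSpace X] (n : ℕ) :=
  PMF (Program (X × Bool) n (X → Bool))

namespace Learner

variable {X : Type*} [MeasurableSpace X] {n : ℕ}

/-- Every realization of the internal randomness gives an `ε`-LDP program. -/
def IsLDP (A : Learner X n) (ε : ℝ) : Prop := ∀ p ∈ A.support, p.IsLDP ε

/-- Every realization of the internal randomness gives a label-non-adaptive program. -/
def LabelNonAdaptive (A : Learner X n) : Prop := ∀ p ∈ A.support, p.LabelNonAdaptive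

/-- The distribution of the hypothesis on the dataset `S`, over the internal randomness and the
randomness of the oracle. -/
def run (A : Learner X n) (S : Fin n → X × Bool) : PMF (X → Bool) := A.bind fun p => p.run S

/-- Distribution-independent PAC learning of `C` with error `α`: for every target `f ∈ C` and every
distribution `D`, on `n` i.i.d. examples `(x, f x)` with `x ∼ D`, the hypothesis has error at most
`α` with probability at least `2/3`, over the examples and all the randomness. -/
def PACLearns (A : Learner X n) (C : Set (X → Bool)) (α : ℝ) : Prop :=
  ∀ f ∈ C, ∀ (D : MeasureTheory.Measure X) [MeasureTheory.IsProbabilityMeasure D],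
    (2 / 3 : ℝ≥0∞) ≤ ∫⁻ x : Fin n → X,
      (A.run fun i => (x i, f (x i))).toOuterMeasure
        {h | D {z | f z ≠ h z} ≤ ENNReal.ofReal α} ∂(MeasureTheory.Measure.pi fun _ => D)

end Learner

end LDP

end

/-!
The learner runs stochastic gradient descent on the convex loss `max |z| γ - y z`, where `z` is a
linear prediction, `y` the label and `γ = 1 / M` the margin. This loss is nonnegative, vanishes on
predictions of margin at least `γ`, and is at least `γ` on wrong predictions, so a risk below `α γ`
gives error below `α`. Its gradient is the sum of a term that depends on the current point but not
on the label, and of a term `-y φ(x)` that depends on the label but not on the current point. Hence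
the adaptive queries can be made label-independent and the label-dependent ones fixed in advance.

Each step uses a fresh example and asks two queries to it, one for each part of the gradient, with
privacy parameter `min ε 1 / 2`. The response is a uniformly random coordinate together with a
biased random sign, which gives an unbiased estimate of the gradient. The usual potential argument
(`SGD.sum_sq_dist_step_le`, `SGD.sum_integral_mul_potential_le`, `SGD.lintegral_run_le`) bounds the
expected risk of the average of the iterates, and Markov's inequality bounds the probability of a
bad hypothesis.

The noise grows with the dimension, and the dimension of the embedding is not bounded in terms of
the margin. So the descent runs on `k` random features, the truncated inner products of `Ψ x` with
random sign vectors drawn as internal randomness. By a variance computation and the fourth moment of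
Rademacher sums (`expect_abs_projection_sub_le`), they preserve a given inner product in mean up to
an error that depends on `k` and the truncation level only. As the loss is Lipschitz, this gives a
comparator of small risk (`expect_potential_le`) for every target and distribution.

Finally, nothing is assumed about the measurability of `Ψ`, but a class with an embedding of positive
margin is finite (`SeparableWith.finite`), so `Ψ` can be replaced by a measurable map that is
constant on the cells cut out by the class (`SeparableWith.exists_measurable`).
-/

namespace LDP

noncomputable section

open MeasureTheory Finset

open scoped BigOperators

/-! ### Finiteness of the class and measurability of the embedding -/

/-- A class with a positive-margin embedding into a finite-dimensional space is finite: if `f` and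
`g` differ somewhere, then their weight vectors are at distance at least `2 / M`, and the unit ball
is totally bounded. -/
theorem SeparableWith.finite {X : Type*} {C : Set (X → Bool)} {M : ℝ} (hM : 0 < M)
    (h : SeparableWith C M) : C.Finite := by
  obtain ⟨d, Ψ, hΨ, hC⟩ := h
  choose! w hw1 hw using hC
  have htb : TotallyBounded (Metric.closedBall (0 : EuclideanSpace ℝ (Fin d)) 1) :=
    (isCompact_closedBall _ _).totallyBounded
  obtain ⟨t, ht, hcov⟩ := Metric.totallyBounded_iff.1 htb (1 / M) (by positivity)
  have hex : ∀ f ∈ C, ∃ y ∈ t, dist (w f) y < 1 / M := by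
    intro f hf
    have := hcov (show w f ∈ Metric.closedBall 0 1 by simpa using hw1 f hf)
    simpa using this
  choose! y hyt hy using hex
  refine Set.Finite.of_finite_image (ht.subset (Set.image_subset_iff.2 fun f hf => hyt f hf)) ?_
  intro f hf g hg hfg
  have hdist : ‖w f - w g‖ < 2 / M := by
    have h1 := hy f hf
    have h2 := hy g hg
    rw [← hfg] at h2
    have := dist_triangle_right (w f) (w g) (y f)
    rw [← dist_eq_norm]
    have e : 2 / M = 1 / M + 1 / M := by ring
    linarith
  funext x
  by_contra hne
  have h1 := hw f hf x
  have h2 := hw g hg x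
  have h3 : 2 / M ≤ |inner ℝ (w f - w g) (Ψ x)| := by
    rw [inner_sub_left]
    have e : 2 / M = 1 / M + 1 / M := by ring
    rw [e]
    cases hfx : f x <;> cases hgx : g x <;> simp_all [sgn]
    · exact le_trans (by linarith) (neg_le_abs _)
    · exact le_trans (by linarith) (le_abs_self _)
  have h4 := abs_real_inner_le_norm (w f - w g) (Ψ x)
  have h5 : ‖w f - w g‖ * ‖Ψ x‖ ≤ ‖w f - w g‖ :=
    mul_le_of_le_one_right (norm_nonneg _) (hΨ x)
  linarith

/-- A separating embedding of a class of measurable functions can be chosen measurable, by making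
it constant on the finitely many cells on which every `f ∈ C` is constant. -/
theorem SeparableWith.exists_measurable {X : Type*} [MeasurableSpace X] {C : Set (X → Bool)}
    {M : ℝ} (hM : 0 < M) (hmeas : ∀ f ∈ C, Measurable f) (h : SeparableWith C M) :
    ∃ (d : ℕ) (Ψ : X → EuclideanSpace ℝ (Fin d)), Measurable Ψ ∧ (∀ x, ‖Ψ x‖ ≤ 1) ∧
      ∀ f ∈ C, ∃ w : EuclideanSpace ℝ (Fin d), ‖w‖ ≤ 1 ∧
        ∀ x, 1 / M ≤ sgn (f x) * inner ℝ w (Ψ x) := by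
  classical
  have hfin : Finite C := h.finite hM
  obtain ⟨d, Ψ, hΨ, hC⟩ := h
  rcases isEmpty_or_nonempty X with hX | hX
  · exact ⟨d, Ψ, measurable_of_empty _, hΨ, hC⟩
  let cell : X → (C → Bool) := fun x f => f.1 x
  have hcell : Measurable cell := measurable_pi_lambda _ fun f => hmeas f.1 f.2
  let pick : (C → Bool) → X := fun s => if h : ∃ x, cell x = s then h.choose else hX.some
  have hpick : ∀ x, cell (pick (cell x)) = cell x := by
    intro x
    have hx : ∃ x', cell x' = cell x := ⟨x, rfl⟩
    simp only [pick, dif_pos hx]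
    exact hx.choose_spec
  refine ⟨d, fun x => Ψ (pick (cell x)), ?_, fun x => hΨ _, fun f hf => ?_⟩
  · exact (measurable_of_countable fun s => Ψ (pick s)).comp hcell
  · obtain ⟨w, hw, hwx⟩ := hC f hf
    refine ⟨w, hw, fun x => ?_⟩
    have : f (pick (cell x)) = f x := congrFun (hpick x) ⟨f, hf⟩
    rw [← this]
    exact hwx _

/-! ### Moments of Rademacher sums and random features -/

theorem expect_cons {R : Type*} [Fintype R] {k : ℕ} (F : (Fin (k + 1) → R) → ℝ) :
    𝔼 s, F s = 𝔼 a : R, 𝔼 s : Fin k → R, F (Fin.cons a s) := by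
  rw [← Finset.expect_product' univ univ fun a s => F (Fin.cons a s)]
  exact (Fintype.expect_equiv (Fin.consEquiv fun _ => R) _ _ fun _ => rfl).symm

theorem expect_bool (F : Bool → ℝ) : 𝔼 b, F b = (F true + F false) / 2 := by
  rw [Fintype.expect_eq_sum_div_card]
  simp

theorem expect_sum_coord {R : Type*} [Fintype R] [Nonempty R] (k : ℕ) (h : R → ℝ) :
    𝔼 r : Fin k → R, ∑ j, h (r j) = k * 𝔼 a, h a := by
  induction k with
  | zero => simp
  | succ k ih =>
    rw [expect_cons]
    simp only [Fin.sum_univ_succ, Fin.cons_zero, Fin.cons_succ, expect_add_distrib,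
      Fintype.expect_const, ih]
    push_cast
    ring

/-- The variance of a sum of `k` independent copies of a centred variable. -/
theorem expect_sq_sum_coord {R : Type*} [Fintype R] [Nonempty R] (k : ℕ) (h : R → ℝ)
    (h0 : 𝔼 a, h a = 0) :
    𝔼 r : Fin k → R, (∑ j, h (r j)) ^ 2 = k * 𝔼 a, h a ^ 2 := by
  induction k with
  | zero => simp
  | succ k ih =>
    rw [expect_cons]
    simp only [Fin.sum_univ_succ, Fin.cons_zero, Fin.cons_succ, add_sq, expect_add_distrib,
      Fintype.expect_const, ih, ← mul_expect, ← expect_mul, expect_sum_coord, h0]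
    push_cast
    ring

/-- The Rademacher sum `∑ ± v j` with signs `s`. -/
def rad {d : ℕ} (v : Fin d → ℝ) (s : Fin d → Bool) : ℝ := ∑ j, sgn (s j) * v j

theorem rad_cons {d : ℕ} (v : Fin (d + 1) → ℝ) (b : Bool) (s : Fin d → Bool) :
    rad v (Fin.cons b s) = sgn b * v 0 + rad (fun j => v j.succ) s := by
  simp [rad, Fin.sum_univ_succ]

theorem expect_rad {d : ℕ} (v : Fin d → ℝ) : 𝔼 s, rad v s = 0 := by
  induction d with
  | zero => simp [rad]
  | succ d ih =>
    rw [expect_cons]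
    simp only [rad_cons, expect_add_distrib, Fintype.expect_const, ih, expect_bool, sgn]
    simp

theorem expect_rad_mul {d : ℕ} (v w : Fin d → ℝ) :
    𝔼 s, rad v s * rad w s = ∑ j, v j * w j := by
  induction d with
  | zero => simp [rad]
  | succ d ih =>
    rw [expect_cons]
    simp only [rad_cons, mul_add, add_mul, expect_add_distrib, Fintype.expect_const, ih,
      ← mul_expect, ← expect_mul, expect_rad, expect_bool, sgn, Fin.sum_univ_succ]
    simp

theorem expect_rad_sq {d : ℕ} (v : Fin d → ℝ) : 𝔼 s, rad v s ^ 2 = ∑ j, v j ^ 2 := by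
  simpa [sq] using expect_rad_mul v v

/-- Khintchine's inequality for the fourth moment. -/
theorem expect_rad_pow_four_le {d : ℕ} (v : Fin d → ℝ) :
    𝔼 s, rad v s ^ 4 ≤ 3 * (∑ j, v j ^ 2) ^ 2 := by
  induction d with
  | zero => simp [rad]
  | succ d ih =>
    have key : 𝔼 s, rad v s ^ 4 = v 0 ^ 4 + 6 * v 0 ^ 2 * (∑ j : Fin d, v j.succ ^ 2) +
        𝔼 s, rad (fun j => v j.succ) s ^ 4 := by
      rw [expect_cons, expect_bool, ← expect_add_distrib, expect_div,
        ← expect_rad_sq (fun j => v j.succ), mul_expect]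
      conv_rhs => rw [← Fintype.expect_const (ι := Fin d → Bool) (v 0 ^ 4)]
      rw [← expect_add_distrib, ← expect_add_distrib]
      refine expect_congr rfl fun s _ => ?_
      simp only [rad_cons, sgn, if_true, Bool.false_eq_true, if_false]
      ring
    rw [key, Fin.sum_univ_succ]
    have := ih fun j => v j.succ
    nlinarith [sq_nonneg (v 0 ^ 2)]

/-- Truncation of a real number to `[-B, B]`. -/
def clip (B a : ℝ) : ℝ := max (-B) (min B a)

theorem abs_clip_le {B : ℝ} (hB : 0 ≤ B) (a : ℝ) : |clip B a| ≤ B := by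
  rw [abs_le]
  exact ⟨le_max_left _ _, max_le (by linarith) (min_le_left _ _)⟩

theorem abs_clip_sub_le {B : ℝ} (hB : 0 < B) (a : ℝ) : |clip B a - a| ≤ a ^ 2 / B := by
  rw [le_div_iff₀ hB]
  unfold clip
  rcases le_total B a with h | h
  · rw [min_eq_left h, max_eq_right (by linarith), abs_of_nonpos (by linarith)]
    nlinarith
  · rw [min_eq_right h]
    rcases le_total (-B) a with h' | h'
    · rw [max_eq_right h', sub_self, abs_zero, zero_mul]
      positivity
    · rw [max_eq_left h', abs_of_nonneg (by linarith)]
      nlinarith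

/-- Truncating one factor at level `B` biases the random-sign estimate of an inner product of two
vectors of the unit ball by at most `2 / B`. -/
theorem abs_expect_rad_mul_clip_sub_le {d : ℕ} {v w : Fin d → ℝ} (hv : ∑ j, v j ^ 2 ≤ 1)
    (hw : ∑ j, w j ^ 2 ≤ 1) {B : ℝ} (hB : 0 < B) :
    |𝔼 s, rad w s * clip B (rad v s) - ∑ j, w j * v j| ≤ 2 / B := by
  rw [← expect_rad_mul, ← expect_sub_distrib]
  calc _ ≤ 𝔼 s, |rad w s * clip B (rad v s) - rad w s * rad v s| := abs_expect_le _ _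
    _ ≤ 𝔼 s, (rad w s ^ 2 + rad v s ^ 4) * (1 / (2 * B)) := by
        refine expect_le_expect fun s _ => ?_
        rw [← mul_sub, abs_mul]
        calc _ ≤ |rad w s| * (rad v s ^ 2 / B) := by
              gcongr
              exact abs_clip_sub_le hB _
          _ = (2 * |rad w s| * rad v s ^ 2) * (1 / (2 * B)) := by field_simp
          _ ≤ _ := by
              gcongr
              nlinarith [sq_nonneg (|rad w s| - rad v s ^ 2), sq_abs (rad w s)]
    _ ≤ (1 + 3) * (1 / (2 * B)) := by
        rw [← expect_mul, expect_add_distrib, expect_rad_sq]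
        have := expect_rad_pow_four_le v
        have h2 : (∑ j, v j ^ 2) ^ 2 ≤ 1 := pow_le_one₀ (sum_nonneg fun j _ => sq_nonneg _) hv
        gcongr
        linarith
    _ = 2 / B := by field_simp; norm_num

/-- A random projection with truncated features preserves an inner product of two vectors of the
unit ball, in mean and up to an error that does not depend on the dimension. -/
theorem expect_abs_projection_sub_le {d k : ℕ} (hk : 0 < k) {v w : Fin d → ℝ}
    (hv : ∑ j, v j ^ 2 ≤ 1) (hw : ∑ j, w j ^ 2 ≤ 1) {B δ : ℝ} (hB : 0 < B) (hδ : 0 < δ) :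
    𝔼 r : Fin k → Fin d → Bool,
      |(∑ j, rad w (r j) * clip B (rad v (r j))) / k - ∑ i, w i * v i| ≤
        2 / B + (B ^ 2 / k / (2 * δ) + δ / 2) := by
  set h : (Fin d → Bool) → ℝ := fun s => rad w s * clip B (rad v s) with hh
  set μ := 𝔼 s, h s with hμ
  have hk' : (0 : ℝ) < k := by exact_mod_cast hk
  have hbias : |μ - ∑ i, w i * v i| ≤ 2 / B := abs_expect_rad_mul_clip_sub_le hv hw hB
  have hsq : 𝔼 s, (h s - μ) ^ 2 ≤ B ^ 2 := by
    have e1 : 𝔼 s, (h s - μ) ^ 2 = 𝔼 s, h s ^ 2 - μ ^ 2 := by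
      simp only [sub_sq, expect_add_distrib, expect_sub_distrib, Fintype.expect_const,
        ← expect_mul, ← mul_expect, ← hμ]
      ring
    have e2 : 𝔼 s, h s ^ 2 ≤ 𝔼 s, rad w s ^ 2 * B ^ 2 := by
      refine expect_le_expect fun s _ => ?_
      simp only [hh, mul_pow]
      have := abs_le.1 (abs_clip_le hB.le (rad v s))
      exact mul_le_mul_of_nonneg_left (sq_le_sq' this.1 this.2) (sq_nonneg _)
    rw [← expect_mul, expect_rad_sq] at e2
    nlinarith [sq_nonneg μ, sq_nonneg B]
  have hvar : 𝔼 r : Fin k → Fin d → Bool, ((∑ j, h (r j)) / k - μ) ^ 2 ≤ B ^ 2 / k := by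
    have e : ∀ r : Fin k → Fin d → Bool,
        ((∑ j, h (r j)) / k - μ) ^ 2 = (∑ j, (h (r j) - μ)) ^ 2 * (1 / (k : ℝ) ^ 2) := by
      intro r
      rw [sum_sub_distrib]
      simp only [sum_const, card_univ, Fintype.card_fin, nsmul_eq_mul]
      field_simp
    simp only [e]
    rw [← expect_mul, expect_sq_sum_coord k (fun s => h s - μ)
      (by rw [expect_sub_distrib, Fintype.expect_const, sub_self])]
    calc _ ≤ (k * B ^ 2) * (1 / (k : ℝ) ^ 2) := by gcongr
      _ = _ := by field_simp
  calc _ ≤ 𝔼 r : Fin k → Fin d → Bool,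
        (2 / B + (((∑ j, h (r j)) / k - μ) ^ 2 * (1 / (2 * δ)) + δ / 2)) := by
        refine expect_le_expect fun r _ => ?_
        set Z := (∑ j, h (r j)) / (k : ℝ)
        have t1 : |Z - ∑ i, w i * v i| ≤ |Z - μ| + |μ - ∑ i, w i * v i| := abs_sub_le _ _ _
        have t2 : |Z - μ| ≤ (Z - μ) ^ 2 * (1 / (2 * δ)) + δ / 2 := by
          have : (Z - μ) ^ 2 * (1 / (2 * δ)) + δ / 2 - |Z - μ| =
              (|Z - μ| - δ) ^ 2 * (1 / (2 * δ)) := by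
            rw [← sq_abs (Z - μ)]
            field_simp
            ring
          have : 0 ≤ (|Z - μ| - δ) ^ 2 * (1 / (2 * δ)) := by positivity
          linarith
        linarith
    _ = 2 / B + ((𝔼 r : Fin k → Fin d → Bool, ((∑ j, h (r j)) / k - μ) ^ 2) * (1 / (2 * δ))
          + δ / 2) := by
        simp only [expect_add_distrib, Fintype.expect_const, ← expect_mul]
    _ ≤ 2 / B + (B ^ 2 / k * (1 / (2 * δ)) + δ / 2) := by gcongr
    _ = _ := by ring

/-! ### The local randomizer and the interactive program -/

theorem abs_sgn (b : Bool) : |sgn b| = 1 := by cases b <;> simp [sgn]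

theorem sgn_sq (b : Bool) : sgn b ^ 2 = 1 := by cases b <;> simp [sgn]

/-- The probability of the response `(j, b)` of the randomizer that picks a coordinate `j` of a
vector `v ∈ [-1, 1]^k` uniformly and reports a random sign `b` of bias `c * v j`. -/
def respProb {k : ℕ} (c : ℝ) (v : Fin k → ℝ) (r : Fin k × Bool) : ℝ :=
  (1 + c * (sgn r.2 * v r.1)) / (2 * k)

section respProb

variable {k : ℕ} {c : ℝ} {v : Fin k → ℝ}

theorem abs_sgn_mul_le (hv : ∀ j, |v j| ≤ 1) (r : Fin k × Bool) : |sgn r.2 * v r.1| ≤ 1 := by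
  rw [abs_mul, abs_sgn, one_mul]
  exact hv _

theorem respProb_nonneg (hc0 : 0 ≤ c) (hc1 : c ≤ 1) (hv : ∀ j, |v j| ≤ 1) (r : Fin k × Bool) :
    0 ≤ respProb c v r := by
  have := (abs_le.1 (abs_sgn_mul_le hv r)).1
  refine div_nonneg ?_ (by positivity)
  nlinarith

theorem sum_respProb_mul (hk : 0 < k) (a : Fin k → ℝ) :
    ∑ r, respProb c v r * (sgn r.2 * a r.1) = c / k * ∑ j, v j * a j := by
  have hk' : (k : ℝ) ≠ 0 := by positivity
  rw [Fintype.sum_prod_type, mul_sum]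
  refine sum_congr rfl fun j _ => ?_
  simp only [Fintype.sum_bool, respProb, sgn, if_true, Bool.false_eq_true, if_false]
  field_simp
  ring

theorem sum_respProb (hk : 0 < k) : ∑ r, respProb c v r = 1 := by
  have hk' : (k : ℝ) ≠ 0 := by positivity
  rw [Fintype.sum_prod_type]
  have : ∀ j, ∑ b, respProb c v (j, b) = 1 / k := by
    intro j
    simp only [Fintype.sum_bool, respProb, sgn, if_true, Bool.false_eq_true, if_false]
    field_simp
    ring
  simp_rw [this]
  simp [hk']

/-- The likelihood ratio of a response is at most `(1 + c) / (1 - c)`, which is at most `e ^ η`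
when `c ≤ η / 3` and `η ≤ 1`. -/
theorem respProb_le {η : ℝ} (hη : η ≤ 1) (hc0 : 0 ≤ c) (hc : c ≤ η / 3)
    (hv : ∀ j, |v j| ≤ 1) {v' : Fin k → ℝ} (hv' : ∀ j, |v' j| ≤ 1) (r : Fin k × Bool) :
    respProb c v r ≤ Real.exp η * respProb c v' r := by
  have h1 := (abs_le.1 (abs_sgn_mul_le hv r)).2
  have h2 := (abs_le.1 (abs_sgn_mul_le hv' r)).1
  have h3 := Real.add_one_le_exp η
  unfold respProb
  rw [← mul_div_assoc]
  gcongr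
  calc 1 + c * (sgn r.2 * v r.1) ≤ 1 + c := by nlinarith
    _ ≤ (η + 1) * (1 - c) := by nlinarith
    _ ≤ _ := by
        gcongr
        · linarith
        · nlinarith [mul_nonneg hc0 (by linarith : 0 ≤ sgn r.2 * v' r.1 + 1)]

end respProb

/-- The local randomizer that reports a uniformly random coordinate of the vector
`v z ∈ [-1, 1]^k`, together with a noisy sign of its value. -/
def signRandomizer {Z : Type*} [MeasurableSpace Z] {k : ℕ} (hk : 0 < k) {η c : ℝ} (hη : η ≤ 1)
    (hc0 : 0 ≤ c) (hc : c ≤ η / 3) (v : Z → Fin k → ℝ) (hv : ∀ z j, |v z j| ≤ 1)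
    (hmeas : Measurable v) : LocalRandomizer Z η where
  W := Fin k × Bool
  law z := PMF.ofFintype (fun r => ENNReal.ofReal (respProb c (v z) r)) (by
    rw [← ENNReal.ofReal_sum_of_nonneg fun r _ => respProb_nonneg hc0 (by linarith) (hv z) r,
      sum_respProb hk, ENNReal.ofReal_one])
  measurable_law r := by
    simp only [PMF.ofFintype_apply]
    refine ENNReal.measurable_ofReal.comp ?_
    unfold respProb
    have : Measurable fun z => v z r.1 := (measurable_pi_apply _).comp hmeas
    fun_prop
  law_le z₁ z₂ r := by
    simp only [PMF.ofFintype_apply]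
    rw [← ENNReal.ofReal_mul (Real.exp_pos _).le]
    exact ENNReal.ofReal_le_ofReal (respProb_le hη hc0 hc (hv z₁) (hv z₂) r)

/-- The derivative of the convex function `z ↦ max |z| γ` (with a choice at `z = ± γ`). -/
def slope (γ z : ℝ) : ℝ := if γ < z then 1 else if z < -γ then -1 else 0

theorem abs_slope_le (γ z : ℝ) : |slope γ z| ≤ 1 := by
  unfold slope
  split_ifs <;> simp

theorem measurable_slope (γ : ℝ) : Measurable (slope γ) :=
  Measurable.ite measurableSet_Ioi measurable_const
    (Measurable.ite measurableSet_Iio measurable_const measurable_const)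

/-- The prediction of the linear predictor `u` on features `φ`. -/
def pred {X : Type*} {k : ℕ} (φ : X → Fin k → ℝ) (u : Fin k → ℝ) (x : X) : ℝ := ∑ j, u j * φ x j

theorem measurable_pred {X : Type*} [MeasurableSpace X] {k : ℕ} {φ : X → Fin k → ℝ}
    (hφ : Measurable φ) (u : Fin k → ℝ) : Measurable (pred φ u) := by
  unfold pred
  have : ∀ j, Measurable fun x => φ x j := fun j => (measurable_pi_apply j).comp hφ
  fun_prop

theorem measurable_sgn : Measurable sgn := measurable_of_countable _

/-- The parameters of the stochastic gradient descent: the number `k` of features, the features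
`φ`, the privacy parameter `η` and the bias `c` of one response, the threshold `γ` of the loss and
the step size `τ`. -/
structure SGD (X : Type*) [MeasurableSpace X] where
  k : ℕ
  k_pos : 0 < k
  φ : X → Fin k → ℝ
  measurable_φ : Measurable φ
  abs_φ_le : ∀ x j, |φ x j| ≤ 1
  η : ℝ
  η_nonneg : 0 ≤ η
  η_le : η ≤ 1
  c : ℝ
  c_pos : 0 < c
  c_le : c ≤ η / 3
  γ : ℝ
  γ_pos : 0 < γ
  τ : ℝ
  τ_pos : 0 < τ

namespace SGD

variable {X : Type*} [MeasurableSpace X] (G : SGD X)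

/-- The label-independent part of the gradient of the loss at `w`, on one example. -/
def pointGrad (w : Fin G.k → ℝ) (z : X × Bool) (j : Fin G.k) : ℝ :=
  slope G.γ (pred G.φ w z.1) * G.φ z.1 j

/-- Minus the label-dependent part of the gradient of the loss, which is the same at all `w`. -/
def labelGrad (z : X × Bool) (j : Fin G.k) : ℝ := sgn z.2 * G.φ z.1 j

theorem abs_pointGrad_le (w : Fin G.k → ℝ) (z : X × Bool) (j : Fin G.k) :
    |G.pointGrad w z j| ≤ 1 := by
  rw [pointGrad, abs_mul]
  exact mul_le_one₀ (abs_slope_le _ _) (abs_nonneg _) (G.abs_φ_le _ _)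

theorem abs_labelGrad_le (z : X × Bool) (j : Fin G.k) : |G.labelGrad z j| ≤ 1 := by
  rw [labelGrad, abs_mul, abs_sgn, one_mul]
  exact G.abs_φ_le _ _

theorem measurable_φ_apply (j : Fin G.k) : Measurable fun x => G.φ x j :=
  (measurable_pi_apply j).comp G.measurable_φ

theorem measurable_pointGrad (w : Fin G.k → ℝ) : Measurable (G.pointGrad w) :=
  measurable_pi_lambda _ fun j =>
    ((measurable_slope _).comp ((measurable_pred G.measurable_φ w).comp measurable_fst)).mul
      ((G.measurable_φ_apply j).comp measurable_fst)

theorem measurable_labelGrad : Measurable G.labelGrad :=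
  measurable_pi_lambda _ fun j =>
    (measurable_sgn.comp measurable_snd).mul ((G.measurable_φ_apply j).comp measurable_fst)

/-- The label-independent query to the example `i`, for a gradient at the current point `w`. -/
def pointQuery {n : ℕ} (i : Fin n) (w : Fin G.k → ℝ) : Query (X × Bool) n where
  index := i
  eps := G.η
  eps_nonneg := G.η_nonneg
  rand := signRandomizer G.k_pos G.η_le G.c_pos.le G.c_le (G.pointGrad w) (G.abs_pointGrad_le w)
    (G.measurable_pointGrad w)

/-- The label-dependent query to the example `i`, which is the same at all points. -/
def labelQuery {n : ℕ} (i : Fin n) : Query (X × Bool) n where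
  index := i
  eps := G.η
  eps_nonneg := G.η_nonneg
  rand := signRandomizer G.k_pos G.η_le G.c_pos.le G.c_le G.labelGrad G.abs_labelGrad_le
    G.measurable_labelGrad

/-- The vector `(k / c) b e_j`: on the response `(j, b)` it is an unbiased estimate of the vector
on which the randomizer was run. -/
def estimate (r : Fin G.k × Bool) (j : Fin G.k) : ℝ :=
  if j = r.1 then G.k / G.c * sgn r.2 else 0

/-- One step of gradient descent from `w`, on the two responses `r₁` and `r₂`. -/
def step (w : Fin G.k → ℝ) (r₁ r₂ : Fin G.k × Bool) (j : Fin G.k) : ℝ :=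
  w j - G.τ * (G.estimate r₁ j - G.estimate r₂ j)

/-- The last `m` steps of the descent, from the point `w`; they use the examples `m - 1, …, 0`,
one each. The vector `s` is the sum of the points visited before, and the final hypothesis is the
sign of the linear predictor given by the sum of all points. -/
def prog {n : ℕ} : (m : ℕ) → m ≤ n → (w s : Fin G.k → ℝ) → Program (X × Bool) n (X → Bool)
  | 0, _, _, s => .output fun x => decide (0 < pred G.φ s x)
  | m + 1, h, w, s =>
    .query (G.pointQuery ⟨m, h⟩ w) fun r₁ => .query (G.labelQuery ⟨m, h⟩) fun r₂ =>
      prog m (Nat.le_of_succ_le h) (G.step w r₁ r₂) (s + w)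

theorem asks_succ {n m : ℕ} (h : m + 1 ≤ n) {w s : Fin G.k → ℝ} {L : List (Query (X × Bool) n)}
    (hL : (G.prog (m + 1) h w s).Asks L) :
    ∃ w' s' L', (G.prog m (Nat.le_of_succ_le h) w' s').Asks L' ∧
      L = G.pointQuery ⟨m, h⟩ w :: G.labelQuery ⟨m, h⟩ :: L' := by
  rw [prog] at hL
  cases hL with
  | query _ _ r₁ L₁ h₁ =>
    cases h₁ with
    | query _ _ r₂ L₂ h₂ => exact ⟨_, _, _, h₂, rfl⟩

theorem asks_zero {n : ℕ} (h : 0 ≤ n) {w s : Fin G.k → ℝ} {L : List (Query (X × Bool) n)}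
    (hL : (G.prog 0 h w s).Asks L) : L = [] := by
  rw [prog] at hL
  cases hL
  rfl

theorem index_lt_of_asks {n : ℕ} : ∀ (m : ℕ) (h : m ≤ n) (w s : Fin G.k → ℝ)
    (L : List (Query (X × Bool) n)), (G.prog m h w s).Asks L → ∀ q ∈ L, (q.index : ℕ) < m
  | 0, h, w, s, L, hL => by simp [G.asks_zero h hL]
  | m + 1, h, w, s, L, hL => by
    obtain ⟨w', s', L', hL', rfl⟩ := G.asks_succ h hL
    have ih := index_lt_of_asks m _ w' s' L' hL'
    intro q hq
    rcases List.mem_cons.1 hq with rfl | hq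
    · exact Nat.lt_succ_self m
    rcases List.mem_cons.1 hq with rfl | hq
    · exact Nat.lt_succ_self m
    · exact (ih q hq).trans (Nat.lt_succ_self m)

theorem isLDP_prog {n : ℕ} : ∀ (m : ℕ) (h : m ≤ n) (w s : Fin G.k → ℝ),
    (G.prog m h w s).IsLDP (2 * G.η)
  | 0, h, w, s => by
    intro L hL i
    rw [G.asks_zero h hL]
    simpa using G.η_nonneg
  | m + 1, h, w, s => by
    intro L hL i
    obtain ⟨w', s', L', hL', rfl⟩ := G.asks_succ h hL
    have ih := isLDP_prog m _ w' s' L' hL' i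
    by_cases hi : (⟨m, h⟩ : Fin n) = i
    -- The queries to the example `m` are the two queries of this step only.
    · have hnil : (L'.filter fun q => q.index = i) = [] := by
        rw [List.filter_eq_nil_iff]
        intro q hq hqi
        have h1 := G.index_lt_of_asks m _ w' s' L' hL' q hq
        have h2 : q.index = i := by simpa using hqi
        rw [h2, ← hi] at h1
        exact lt_irrefl _ h1
      have e₁ : (G.pointQuery ⟨m, h⟩ w).index = i := hi
      have e₂ : (G.labelQuery ⟨m, h⟩).index = i := hi
      have e₃ : (G.pointQuery ⟨m, h⟩ w).eps = G.η := rfl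
      have e₄ : (G.labelQuery ⟨m, h⟩).eps = G.η := rfl
      simp [e₁, e₂, e₃, e₄, hnil, two_mul]
    · have e₁ : (G.pointQuery ⟨m, h⟩ w).index ≠ i := hi
      have e₂ : (G.labelQuery ⟨m, h⟩).index ≠ i := hi
      simpa [e₁, e₂] using ih

theorem labelIndependent_pointQuery {n : ℕ} (i : Fin n) (w : Fin G.k → ℝ) :
    (G.pointQuery i w).LabelIndependent := fun _ _ _ => rfl

open Classical in
/-- The only queries that depend on labels are the queries `labelQuery i`, which are fixed. -/
theorem exists_filter_eq {n : ℕ} : ∀ (m : ℕ) (h : m ≤ n),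
    ∃ L₀ : List (Query (X × Bool) n), ∀ (w s : Fin G.k → ℝ) L, (G.prog m h w s).Asks L →
      (L.filter fun q => ¬ q.LabelIndependent) = L₀
  | 0, h => ⟨[], fun w s L hL => by simp [G.asks_zero h hL]⟩
  | m + 1, h => by
    obtain ⟨L₀, hL₀⟩ := exists_filter_eq m (Nat.le_of_succ_le h)
    refine ⟨[G.labelQuery ⟨m, h⟩].filter (fun q => ¬ q.LabelIndependent) ++ L₀, ?_⟩
    intro w s L hL
    obtain ⟨w', s', L', hL', rfl⟩ := G.asks_succ h hL
    rw [← hL₀ _ _ _ hL', ← List.filter_append, List.filter_cons_of_neg]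
    · rfl
    · simpa using G.labelIndependent_pointQuery _ w

theorem labelNonAdaptive_prog {n m : ℕ} (h : m ≤ n) (w s : Fin G.k → ℝ) :
    (G.prog m h w s).LabelNonAdaptive := by
  obtain ⟨L₀, hL₀⟩ := G.exists_filter_eq m h
  exact ⟨L₀, hL₀ w s⟩

end SGD

/-! ### The loss function -/

/-- The loss `max |z| g - y z` of the prediction `z` for the label `y`. It is convex in `z`,
vanishes when `z` has the sign `y` and `g ≤ |z|`, and is at least `g` when `z` has the wrong sign.
Its derivative is the sum of a term that does not depend on `y` and of `-y`. -/
def loss (g y z : ℝ) : ℝ := max |z| g - y * z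

theorem loss_nonneg {g y : ℝ} (hy : |y| = 1) (z : ℝ) : 0 ≤ loss g y z := by
  have h1 : y * z ≤ |z| := by
    calc y * z ≤ |y * z| := le_abs_self _
      _ = |z| := by rw [abs_mul, hy, one_mul]
  have := le_max_left |z| g
  unfold loss
  linarith

theorem le_loss {g y z : ℝ} (h : y * z ≤ 0) : g ≤ loss g y z := by
  have := le_max_right |z| g
  unfold loss
  linarith

/-- The loss is jointly subadditive in the threshold and the prediction: it is the perspective of a
convex function. This replaces Jensen's inequality for the average of the iterates. -/
theorem loss_add_le (g g' y z z' : ℝ) : loss (g + g') y (z + z') ≤ loss g y z + loss g' y z' := by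
  have h : max |z + z'| (g + g') ≤ max |z| g + max |z'| g' :=
    max_le ((abs_add_le z z').trans (add_le_add (le_max_left _ _) (le_max_left _ _)))
      (add_le_add (le_max_right _ _) (le_max_right _ _))
  unfold loss
  linarith

theorem loss_sub_le_slope {g : ℝ} (hg : 0 < g) (y z z' : ℝ) :
    loss g y z - loss g y z' ≤ (slope g z - y) * (z - z') := by
  have h : max |z| g + slope g z * (z' - z) ≤ max |z'| g := by
    have h1 := le_max_left |z'| g
    have h2 := le_max_right |z'| g
    have h3 := le_abs_self z'
    have h4 := neg_le_abs z'
    unfold slope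
    split_ifs with hz hz'
    · rw [abs_of_pos (hg.trans hz), max_eq_left hz.le]
      linarith
    · rw [abs_of_neg (by linarith), max_eq_left (by linarith)]
      linarith
    · rw [max_eq_right (abs_le.2 ⟨by linarith, by linarith⟩)]
      linarith
  unfold loss
  nlinarith

/-- The loss is `2`-Lipschitz in the prediction, and vanishes at predictions with margin `g`. -/
theorem loss_le_of_margin {g y m : ℝ} (hg : 0 < g) (hy : |y| = 1) (hm : g ≤ y * m) (z : ℝ) :
    loss g y z ≤ 2 * |z - m| := by
  have h1 : |m| = y * m := by
    rw [← abs_of_pos (hg.trans_le hm), abs_mul, hy, one_mul]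
  have h2 : y * (m - z) ≤ |z - m| := by
    calc y * (m - z) ≤ |y * (m - z)| := le_abs_self _
      _ = |z - m| := by rw [abs_mul, hy, one_mul, abs_sub_comm]
  have h3 : |z| ≤ |m| + |z - m| := by
    have := abs_add_le m (z - m)
    rwa [add_sub_cancel] at this
  have h4 : max |z| g ≤ y * m + |z - m| :=
    max_le (by linarith) (by linarith [abs_nonneg (z - m)])
  unfold loss
  linarith

theorem measurable_loss (g : ℝ) : Measurable fun p : ℝ × ℝ => loss g p.1 p.2 := by
  unfold loss
  exact (measurable_snd.abs.max measurable_const).sub (measurable_fst.mul measurable_snd)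

/-! ### Analysis of the gradient descent -/

/-- In an integral over independent samples, a factor that depends on the sample `i` only splits
off from a factor that does not depend on it. -/
theorem lintegral_pi_mul {X : Type*} [MeasurableSpace X] (D : Measure X) [IsProbabilityMeasure D]
    {n : ℕ} (i : Fin n) {a : X → ℝ≥0∞} (ha : Measurable a) {b : (Fin n → X) → ℝ≥0∞}
    (hb : Measurable b) (hbi : ∀ S x, b (Function.update S i x) = b S) :
    ∫⁻ S, a (S i) * b S ∂(Measure.pi fun _ => D) =
      (∫⁻ x, a x ∂D) * ∫⁻ S, b S ∂(Measure.pi fun _ => D) := by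
  rw [← lintegral_const_mul _ hb]
  refine lintegral_eq_of_lmarginal_eq {i} ((ha.comp (measurable_pi_apply i)).mul hb)
    (hb.const_mul _) ?_
  funext S
  rw [lmarginal_singleton, lmarginal_singleton]
  simp only [hbi, Function.update_self]
  rw [lintegral_mul_const _ ha]
  simp

namespace SGD

variable {X : Type*} [MeasurableSpace X] (G : SGD X)

theorem run_succ {n m : ℕ} (h : m + 1 ≤ n) (w s : Fin G.k → ℝ) (S : Fin n → X × Bool)
    (E : Set (X → Bool)) :
    ((G.prog (m + 1) h w s).run S).toOuterMeasure E =
      ∑ r₁, ∑ r₂, ENNReal.ofReal (respProb G.c (G.pointGrad w (S ⟨m, h⟩)) r₁ *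
        respProb G.c (G.labelGrad (S ⟨m, h⟩)) r₂) *
          ((G.prog m (Nat.le_of_succ_le h) (G.step w r₁ r₂) (s + w)).run S).toOuterMeasure E := by
  have e : ((G.prog (m + 1) h w s).run S).toOuterMeasure E =
      ∑' r₁ : Fin G.k × Bool, ENNReal.ofReal (respProb G.c (G.pointGrad w (S ⟨m, h⟩)) r₁) *
        ((PMF.bind ((G.labelQuery (⟨m, h⟩ : Fin n)).rand.law (S ⟨m, h⟩)) fun r₂ =>
          (G.prog m (Nat.le_of_succ_le h) (G.step w r₁ r₂) (s + w)).run S).toOuterMeasure E) :=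
    PMF.toOuterMeasure_bind_apply _ _ _
  rw [e, tsum_fintype]
  refine sum_congr rfl fun r₁ _ => ?_
  have e' : (PMF.bind ((G.labelQuery (⟨m, h⟩ : Fin n)).rand.law (S ⟨m, h⟩)) fun r₂ =>
        (G.prog m (Nat.le_of_succ_le h) (G.step w r₁ r₂) (s + w)).run S).toOuterMeasure E =
      ∑' r₂ : Fin G.k × Bool, ENNReal.ofReal (respProb G.c (G.labelGrad (S ⟨m, h⟩)) r₂) *
        ((G.prog m (Nat.le_of_succ_le h) (G.step w r₁ r₂) (s + w)).run S).toOuterMeasure E :=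
    PMF.toOuterMeasure_bind_apply _ _ _
  rw [e', tsum_fintype, mul_sum]
  refine sum_congr rfl fun r₂ _ => ?_
  rw [← mul_assoc, ENNReal.ofReal_mul (respProb_nonneg G.c_pos.le
    (by linarith [G.c_le, G.η_le]) (G.abs_pointGrad_le w _) _)]

theorem measurable_respProb {Z : Type*} [MeasurableSpace Z] {k : ℕ} (c : ℝ) {v : Z → Fin k → ℝ}
    (hv : Measurable v) (r : Fin k × Bool) : Measurable fun z => respProb c (v z) r := by
  have : Measurable fun z => v z r.1 := (measurable_pi_apply _).comp hv
  unfold respProb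
  fun_prop

theorem measurable_run {n : ℕ} {f : X → Bool} (hf : Measurable f) (E : Set (X → Bool)) :
    ∀ (m : ℕ) (h : m ≤ n) (w s : Fin G.k → ℝ), Measurable fun S : Fin n → X =>
      ((G.prog m h w s).run fun i => (S i, f (S i))).toOuterMeasure E
  | 0, _, w, s => by simp only [prog, Program.run, measurable_const]
  | m + 1, h, w, s => by
    simp only [run_succ]
    have hz : Measurable fun S : Fin n → X => (S ⟨m, h⟩, f (S ⟨m, h⟩)) :=
      (measurable_pi_apply _).prodMk (hf.comp (measurable_pi_apply _))
    refine Finset.measurable_fun_sum _ fun r₁ _ => Finset.measurable_fun_sum _ fun r₂ _ => ?_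
    refine Measurable.mul (ENNReal.measurable_ofReal.comp ?_) (measurable_run hf E m _ _ _)
    exact (measurable_respProb _ ((G.measurable_pointGrad w).comp hz) _).mul
      (measurable_respProb _ (G.measurable_labelGrad.comp hz) _)

/-- The last `m` steps do not depend on the examples with index at least `m`. -/
theorem run_update {n : ℕ} (f : X → Bool) (E : Set (X → Bool)) (i : Fin n) (x : X)
    (S : Fin n → X) : ∀ (m : ℕ) (h : m ≤ n) (_ : m ≤ i) (w s : Fin G.k → ℝ),
      ((G.prog m h w s).run fun i' => (Function.update S i x i',
        f (Function.update S i x i'))).toOuterMeasure E =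
      ((G.prog m h w s).run fun i' => (S i', f (S i'))).toOuterMeasure E
  | 0, _, _, w, s => by simp only [prog, Program.run]
  | m + 1, h, hi, w, s => by
    have hne : (⟨m, h⟩ : Fin n) ≠ i := fun e => by
      rw [← e] at hi
      exact absurd hi (by simp)
    simp only [run_succ, Function.update_of_ne hne]
    refine sum_congr rfl fun r₁ _ => sum_congr rfl fun r₂ _ => ?_
    rw [run_update f E i x S m _ (Nat.le_of_succ_le hi)]

/-- The expected squared distance to a point `u` after one step of the descent. -/
theorem sum_sq_dist_step_le (w u : Fin G.k → ℝ) (z : X × Bool) :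
    ∑ r₁, ∑ r₂, respProb G.c (G.pointGrad w z) r₁ * respProb G.c (G.labelGrad z) r₂ *
        ∑ j, (G.step w r₁ r₂ j - u j) ^ 2 ≤
      ∑ j, (w j - u j) ^ 2 -
        2 * G.τ * (loss G.γ (sgn z.2) (pred G.φ w z.1) - loss G.γ (sgn z.2) (pred G.φ u z.1)) +
        4 * G.τ ^ 2 * (G.k / G.c) ^ 2 := by
  have hc1 : G.c ≤ 1 := by linarith [G.c_le, G.η_le]
  have hk : (G.k : ℝ) ≠ 0 := by exact_mod_cast G.k_pos.ne'
  set a : Fin G.k → ℝ := fun j => w j - u j with ha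
  set A := ∑ j, a j ^ 2 with hA
  set Q := 4 * G.τ ^ 2 * (G.k / G.c) ^ 2 with hQ
  have hest : ∀ r, ∑ j, a j * G.estimate r j = G.k / G.c * (sgn r.2 * a r.1) := by
    intro r
    simp only [estimate, mul_ite, mul_zero, sum_ite_eq', mem_univ, if_true]
    ring
  have hest2 : ∀ r, ∑ j, G.estimate r j ^ 2 = (G.k / G.c) ^ 2 := by
    intro r
    simp only [estimate, ite_pow, mul_pow, sgn_sq]
    simp
  have hstep : ∀ r₁ r₂, ∑ j, (G.step w r₁ r₂ j - u j) ^ 2 ≤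
      A + Q - 2 * G.τ * (G.k / G.c) * (sgn r₁.2 * a r₁.1) +
        2 * G.τ * (G.k / G.c) * (sgn r₂.2 * a r₂.1) := by
    intro r₁ r₂
    calc ∑ j, (G.step w r₁ r₂ j - u j) ^ 2 ≤
        ∑ j, (a j ^ 2 - 2 * G.τ * (a j * G.estimate r₁ j) + 2 * G.τ * (a j * G.estimate r₂ j) +
          (2 * G.τ ^ 2 * G.estimate r₁ j ^ 2 + 2 * G.τ ^ 2 * G.estimate r₂ j ^ 2)) := by
          refine sum_le_sum fun j _ => ?_
          simp only [step, ha]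
          nlinarith [sq_nonneg (G.τ * (G.estimate r₁ j + G.estimate r₂ j))]
      _ = _ := by
          simp only [sum_add_distrib, sum_sub_distrib, ← mul_sum, hest, hest2, hQ, ← hA]
          ring
  have hp := fun r => respProb_nonneg G.c_pos.le hc1 (G.abs_pointGrad_le w z) r
  have hl := fun r => respProb_nonneg G.c_pos.le hc1 (G.abs_labelGrad_le z) r
  have hsum1 : ∀ v : Fin G.k → ℝ, ∑ r, respProb G.c v r = 1 := fun v => sum_respProb G.k_pos
  have hlin : ∀ v : Fin G.k → ℝ,
      ∑ r, respProb G.c v r * (sgn r.2 * a r.1) = G.c / G.k * ∑ j, v j * a j :=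
    fun v => sum_respProb_mul G.k_pos a
  set p := respProb G.c (G.pointGrad w z) with hpd
  set l := respProb G.c (G.labelGrad z) with hld
  have hlsum : ∑ r, l r = 1 := hsum1 _
  have hgrad : ∑ j, G.pointGrad w z j * a j - ∑ j, G.labelGrad z j * a j =
      (slope G.γ (pred G.φ w z.1) - sgn z.2) * (pred G.φ w z.1 - pred G.φ u z.1) := by
    rw [← sum_sub_distrib]
    conv_rhs => rw [pred.eq_def G.φ w z.1, pred.eq_def G.φ u z.1, ← sum_sub_distrib, mul_sum]
    refine sum_congr rfl fun j _ => ?_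
    simp only [pointGrad, labelGrad, ha, pred]
    ring
  have hconv := loss_sub_le_slope G.γ_pos (sgn z.2) (pred G.φ w z.1) (pred G.φ u z.1)
  rw [← hgrad] at hconv
  calc _ ≤ ∑ r₁, ∑ r₂, p r₁ * l r₂ * (A + Q - 2 * G.τ * (G.k / G.c) * (sgn r₁.2 * a r₁.1) +
        2 * G.τ * (G.k / G.c) * (sgn r₂.2 * a r₂.1)) :=
        sum_le_sum fun r₁ _ => sum_le_sum fun r₂ _ =>
          mul_le_mul_of_nonneg_left (hstep r₁ r₂) (mul_nonneg (hp r₁) (hl r₂))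
    _ = ∑ r₁, (p r₁ * (A + Q) - 2 * G.τ * (G.k / G.c) * (p r₁ * (sgn r₁.2 * a r₁.1)) +
          p r₁ * (2 * G.τ * (G.k / G.c) * ∑ r₂, l r₂ * (sgn r₂.2 * a r₂.1))) := by
        refine sum_congr rfl fun r₁ _ => ?_
        have e : ∀ r₂, p r₁ * l r₂ * (A + Q - 2 * G.τ * (G.k / G.c) * (sgn r₁.2 * a r₁.1) +
            2 * G.τ * (G.k / G.c) * (sgn r₂.2 * a r₂.1)) =
            l r₂ * (p r₁ * (A + Q) - 2 * G.τ * (G.k / G.c) * (p r₁ * (sgn r₁.2 * a r₁.1))) +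
            p r₁ * (2 * G.τ * (G.k / G.c)) * (l r₂ * (sgn r₂.2 * a r₂.1)) := fun r₂ => by ring
        simp only [e, sum_add_distrib, ← sum_mul, ← mul_sum, hlsum]
        ring
    _ = A + Q - 2 * G.τ * (∑ j, G.pointGrad w z j * a j - ∑ j, G.labelGrad z j * a j) := by
        simp only [sum_add_distrib, sum_sub_distrib, ← sum_mul, ← mul_sum, hld, hpd, hsum1, hlin]
        have := G.c_pos.ne'
        field_simp
        ring
    _ ≤ _ := by
        have := mul_le_mul_of_nonneg_left hconv (by linarith [G.τ_pos] : 0 ≤ 2 * G.τ)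
        linarith

/-- The expected loss, with threshold `g`, of the linear predictor `u`. -/
def risk (D : Measure X) (f : X → Bool) (g : ℝ) (u : Fin G.k → ℝ) : ℝ :=
  ∫ x, loss g (sgn (f x)) (pred G.φ u x) ∂D

theorem abs_pred_le (u : Fin G.k → ℝ) (x : X) : |pred G.φ u x| ≤ ∑ j, |u j| := by
  refine (abs_sum_le_sum_abs _ _).trans (sum_le_sum fun j _ => ?_)
  rw [abs_mul]
  exact mul_le_of_le_one_right (abs_nonneg _) (G.abs_φ_le x j)

theorem integrable_loss (D : Measure X) [IsProbabilityMeasure D] {f : X → Bool}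
    (hf : Measurable f) (g : ℝ) (u : Fin G.k → ℝ) :
    Integrable (fun x => loss g (sgn (f x)) (pred G.φ u x)) D := by
  refine Integrable.of_bound (C := (∑ j, |u j|) + |g| + ∑ j, |u j|) ?_ (ae_of_all _ fun x => ?_)
  · exact ((measurable_loss g).comp
      ((measurable_sgn.comp hf).prodMk (measurable_pred G.measurable_φ u))).aestronglyMeasurable
  · have h1 := G.abs_pred_le u x
    have h2 : |sgn (f x) * pred G.φ u x| ≤ ∑ j, |u j| := by rwa [abs_mul, abs_sgn, one_mul]
    have h3 : |max |pred G.φ u x| g| ≤ |pred G.φ u x| + |g| := by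
      refine abs_le.2 ⟨?_, max_le ?_ ?_⟩
      · have := le_max_left |pred G.φ u x| g
        linarith [abs_nonneg (pred G.φ u x), abs_nonneg g]
      · linarith [abs_nonneg g]
      · linarith [abs_nonneg (pred G.φ u x), le_abs_self g]
    rw [Real.norm_eq_abs]
    unfold loss
    exact (abs_sub _ _).trans (by linarith)

theorem risk_add_le (D : Measure X) [IsProbabilityMeasure D] {f : X → Bool}
    (hf : Measurable f) (g g' : ℝ) (u u' : Fin G.k → ℝ) :
    G.risk D f (g + g') (u + u') ≤ G.risk D f g u + G.risk D f g' u' := by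
  unfold risk
  rw [← integral_add (G.integrable_loss D hf g u) (G.integrable_loss D hf g' u')]
  refine integral_mono (G.integrable_loss D hf _ _)
    ((G.integrable_loss D hf g u).add (G.integrable_loss D hf g' u')) fun x => ?_
  have e : pred G.φ (u + u') x = pred G.φ u x + pred G.φ u' x := by
    simp [pred, add_mul, sum_add_distrib]
  simp only [e]
  exact loss_add_le _ _ _ _ _

/-- The risk with threshold `g` bounds `g` times the classification error. -/
theorem mul_error_le_risk (D : Measure X) [IsProbabilityMeasure D] {f : X → Bool}
    (hf : Measurable f) {g : ℝ} (hg : 0 ≤ g) (u : Fin G.k → ℝ) :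
    g * D.real {x | f x ≠ decide (0 < pred G.φ u x)} ≤ G.risk D f g u := by
  have h1 := mul_meas_ge_le_integral_of_nonneg (μ := D)
    (ae_of_all _ fun x => loss_nonneg (g := g) (abs_sgn (f x)) (pred G.φ u x))
    (G.integrable_loss D hf g u) g
  refine le_trans (mul_le_mul_of_nonneg_left (measureReal_mono fun x hx => ?_) hg) h1
  refine le_loss ?_
  simp only [Set.mem_ofPred_eq] at hx
  by_cases hp : 0 < pred G.φ u x <;> cases hfx : f x <;> simp_all [sgn]
  exact hp.le

theorem risk_nonneg (D : Measure X) (f : X → Bool) (g : ℝ) (u : Fin G.k → ℝ) :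
    0 ≤ G.risk D f g u :=
  integral_nonneg fun _ => loss_nonneg (abs_sgn _) _

/-- The standard potential of gradient descent, after `t` steps and before `m` further ones: it
bounds the expected risk of the sum of all iterates. -/
def potential (D : Measure X) (f : X → Bool) (u : Fin G.k → ℝ) (t m : ℕ) (w s : Fin G.k → ℝ) : ℝ :=
  G.risk D f (G.γ * t) s + (∑ j, (w j - u j) ^ 2) / (2 * G.τ) +
    m * (G.risk D f G.γ u + 2 * G.τ * (G.k / G.c) ^ 2)

theorem potential_nonneg (D : Measure X) (f : X → Bool) (u : Fin G.k → ℝ) (t m : ℕ)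
    (w s : Fin G.k → ℝ) : 0 ≤ G.potential D f u t m w s := by
  have h1 := G.risk_nonneg D f (G.γ * t) s
  have h2 := G.risk_nonneg D f G.γ u
  have h3 : 0 ≤ ∑ j, (w j - u j) ^ 2 := sum_nonneg fun j _ => sq_nonneg _
  have h4 := G.τ_pos
  unfold potential
  positivity

theorem integrable_respProb_mul (D : Measure X) [IsProbabilityMeasure D] {f : X → Bool}
    (hf : Measurable f) (w : Fin G.k → ℝ) (r₁ r₂ : Fin G.k × Bool) :
    Integrable (fun x => respProb G.c (G.pointGrad w (x, f x)) r₁ *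
      respProb G.c (G.labelGrad (x, f x)) r₂) D := by
  have hz : Measurable fun x => (x, f x) := measurable_id.prodMk hf
  have hc1 : G.c ≤ 1 := by linarith [G.c_le, G.η_le]
  refine Integrable.of_bound (C := 1) ?_ (ae_of_all _ fun x => ?_)
  · exact ((measurable_respProb _ ((G.measurable_pointGrad w).comp hz) _).mul
      (measurable_respProb _ (G.measurable_labelGrad.comp hz) _)).aestronglyMeasurable
  · have hle : ∀ v : Fin G.k → ℝ, (∀ j, |v j| ≤ 1) → ∀ r, 0 ≤ respProb G.c v r ∧
        respProb G.c v r ≤ 1 := fun v hv r =>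
      ⟨respProb_nonneg G.c_pos.le hc1 hv r, by
        rw [← sum_respProb (v := v) (c := G.c) G.k_pos]
        exact single_le_sum (fun r _ => respProb_nonneg G.c_pos.le hc1 hv r) (mem_univ r)⟩
    have h1 := hle _ (G.abs_pointGrad_le w (x, f x)) r₁
    have h2 := hle _ (G.abs_labelGrad_le (x, f x)) r₂
    rw [Real.norm_eq_abs, abs_of_nonneg (mul_nonneg h1.1 h2.1)]
    exact mul_le_one₀ h1.2 h2.1 h2.2

/-- The potential does not increase in expectation. -/
theorem sum_integral_mul_potential_le (D : Measure X) [IsProbabilityMeasure D] {f : X → Bool}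
    (hf : Measurable f) (u : Fin G.k → ℝ) (t m : ℕ) (w s : Fin G.k → ℝ) :
    ∑ r₁, ∑ r₂, (∫ x, respProb G.c (G.pointGrad w (x, f x)) r₁ *
        respProb G.c (G.labelGrad (x, f x)) r₂ ∂D) *
          G.potential D f u (t + 1) m (G.step w r₁ r₂) (s + w) ≤
      G.potential D f u t (m + 1) w s := by
  have hinteg := G.integrable_respProb_mul D hf w
  set K := G.risk D f (G.γ * (t + 1 : ℕ)) (s + w) +
    m * (G.risk D f G.γ u + 2 * G.τ * (G.k / G.c) ^ 2) with hK
  have hτ := G.τ_pos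
  set A := ∑ j, (w j - u j) ^ 2 with hA
  have hpot : ∀ r₁ r₂, G.potential D f u (t + 1) m (G.step w r₁ r₂) (s + w) =
      K + (∑ j, (G.step w r₁ r₂ j - u j) ^ 2) / (2 * G.τ) := by
    intro r₁ r₂
    simp only [potential, hK]
    ring
  have hpoint : ∀ x, ∑ r₁, ∑ r₂, respProb G.c (G.pointGrad w (x, f x)) r₁ *
        respProb G.c (G.labelGrad (x, f x)) r₂ *
          G.potential D f u (t + 1) m (G.step w r₁ r₂) (s + w) ≤
      (K + A / (2 * G.τ) + 2 * G.τ * (G.k / G.c) ^ 2) -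
        (loss G.γ (sgn (f x)) (pred G.φ w x) - loss G.γ (sgn (f x)) (pred G.φ u x)) := by
    intro x
    have h := G.sum_sq_dist_step_le w u (x, f x)
    have hone : ∑ r₁, ∑ r₂, respProb G.c (G.pointGrad w (x, f x)) r₁ *
        respProb G.c (G.labelGrad (x, f x)) r₂ = 1 := by
      simp only [← mul_sum, sum_respProb G.k_pos, mul_one]
    calc _ = K * (∑ r₁, ∑ r₂, respProb G.c (G.pointGrad w (x, f x)) r₁ *
          respProb G.c (G.labelGrad (x, f x)) r₂) +
          (∑ r₁, ∑ r₂, respProb G.c (G.pointGrad w (x, f x)) r₁ *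
            respProb G.c (G.labelGrad (x, f x)) r₂ * ∑ j, (G.step w r₁ r₂ j - u j) ^ 2) /
            (2 * G.τ) := by
          simp only [hpot, mul_add, sum_add_distrib, mul_div_assoc', ← sum_div, ← sum_mul,
            mul_comm K]
      _ ≤ K * 1 + (A - 2 * G.τ * (loss G.γ (sgn (f x)) (pred G.φ w x) -
            loss G.γ (sgn (f x)) (pred G.φ u x)) + 4 * G.τ ^ 2 * (G.k / G.c) ^ 2) /
            (2 * G.τ) := by
          rw [hone]
          gcongr
      _ = _ := by
          field_simp
          ring
  calc _ = ∫ x, ∑ r₁, ∑ r₂, respProb G.c (G.pointGrad w (x, f x)) r₁ *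
        respProb G.c (G.labelGrad (x, f x)) r₂ *
          G.potential D f u (t + 1) m (G.step w r₁ r₂) (s + w) ∂D := by
        rw [integral_finsetSum _ fun r₁ _ => integrable_finsetSum _ fun r₂ _ =>
          (hinteg r₁ r₂).mul_const _]
        refine sum_congr rfl fun r₁ _ => ?_
        rw [integral_finsetSum _ fun r₂ _ => (hinteg r₁ r₂).mul_const _]
        exact sum_congr rfl fun r₂ _ => (integral_mul_const _ _).symm
    _ ≤ ∫ x, ((K + A / (2 * G.τ) + 2 * G.τ * (G.k / G.c) ^ 2) -
        (loss G.γ (sgn (f x)) (pred G.φ w x) - loss G.γ (sgn (f x)) (pred G.φ u x))) ∂D :=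
        integral_mono (integrable_finsetSum _ fun r₁ _ => integrable_finsetSum _ fun r₂ _ =>
          (hinteg r₁ r₂).mul_const _) ((integrable_const _).sub
            ((G.integrable_loss D hf _ _).sub (G.integrable_loss D hf _ _))) hpoint
    _ = (K + A / (2 * G.τ) + 2 * G.τ * (G.k / G.c) ^ 2) -
        (G.risk D f G.γ w - G.risk D f G.γ u) := by
        have hi : Integrable (fun x => loss G.γ (sgn (f x)) (pred G.φ w x) -
            loss G.γ (sgn (f x)) (pred G.φ u x)) D :=
          (G.integrable_loss D hf _ _).sub (G.integrable_loss D hf _ _)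
        rw [integral_sub (integrable_const _) hi, integral_sub (G.integrable_loss D hf _ _)
          (G.integrable_loss D hf _ _)]
        simp [risk]
    _ ≤ _ := by
        have h := G.risk_add_le D hf (G.γ * t) G.γ s w
        have e : G.γ * ((t + 1 : ℕ) : ℝ) = G.γ * t + G.γ := by push_cast; ring
        simp only [hK, potential, e, ← hA]
        push_cast
        linarith

/-- The probability that the output hypothesis has error more than `α`, after the last `m` of `n`
steps, is bounded by the potential. -/
theorem lintegral_run_le (D : Measure X) [IsProbabilityMeasure D] {f : X → Bool}
    (hf : Measurable f) (u : Fin G.k → ℝ) {α : ℝ} (hα : 0 < α) {n : ℕ} (hn : 0 < n) :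
    ∀ (m : ℕ) (h : m ≤ n) (t : ℕ) (_ : t + m = n) (w s : Fin G.k → ℝ),
      ∫⁻ S : Fin n → X, ((G.prog m h w s).run fun i => (S i, f (S i))).toOuterMeasure
          {g | D {z | f z ≠ g z} ≤ ENNReal.ofReal α}ᶜ ∂(Measure.pi fun _ => D) ≤
        ENNReal.ofReal ((n * G.γ * α)⁻¹ * G.potential D f u t m w s)
  | 0, h, t, ht, w, s => by
    obtain rfl : t = n := by simpa using ht
    have hγ := G.γ_pos
    have hn' : (0 : ℝ) < t := by exact_mod_cast hn
    simp only [prog, Program.run, PMF.toOuterMeasure_pure_apply, lintegral_const, measure_univ,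
      mul_one]
    split_ifs with hbad
    · have hbad' : α < D.real {z | f z ≠ decide (0 < pred G.φ s z)} := by
        simp only [Set.mem_compl_iff, Set.mem_ofPred_eq, not_le] at hbad
        rw [measureReal_def]
        exact (ENNReal.ofReal_lt_iff_lt_toReal hα.le (measure_ne_top _ _)).1 hbad
      have herr := G.mul_error_le_risk D hf (g := G.γ * t) (by positivity) s
      rw [ENNReal.one_le_ofReal, ← div_eq_inv_mul, one_le_div (by positivity)]
      have h3 : 0 ≤ (∑ j, (w j - u j) ^ 2) / (2 * G.τ) :=
        div_nonneg (sum_nonneg fun j _ => sq_nonneg _) (by linarith [G.τ_pos])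
      have h4 : G.γ * t * α ≤ G.γ * t * D.real {z | f z ≠ decide (0 < pred G.φ s z)} := by gcongr
      simp only [potential, Nat.cast_zero, zero_mul, add_zero]
      linarith
    · exact zero_le
  | m + 1, h, t, ht, w, s => by
    have ih := lintegral_run_le D hf u hα hn m (Nat.le_of_succ_le h) (t + 1) (by omega)
    have hγ := G.γ_pos
    have hz : Measurable fun x => (x, f x) := measurable_id.prodMk hf
    have hc1 : G.c ≤ 1 := by linarith [G.c_le, G.η_le]
    set E := {g : X → Bool | D {z | f z ≠ g z} ≤ ENNReal.ofReal α}ᶜ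
    have hp0 : ∀ r₁ r₂ x, 0 ≤ respProb G.c (G.pointGrad w (x, f x)) r₁ *
        respProb G.c (G.labelGrad (x, f x)) r₂ := fun r₁ r₂ x =>
      mul_nonneg (respProb_nonneg G.c_pos.le hc1 (G.abs_pointGrad_le w _) _)
        (respProb_nonneg G.c_pos.le hc1 (G.abs_labelGrad_le _) _)
    have hpm : ∀ r₁ r₂, Measurable fun x => ENNReal.ofReal
        (respProb G.c (G.pointGrad w (x, f x)) r₁ * respProb G.c (G.labelGrad (x, f x)) r₂) :=
      fun r₁ r₂ => ENNReal.measurable_ofReal.comp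
        ((measurable_respProb _ ((G.measurable_pointGrad w).comp hz) _).mul
          (measurable_respProb _ (G.measurable_labelGrad.comp hz) _))
    have hqm : ∀ w s, Measurable fun S : Fin n → X =>
        ((G.prog m (Nat.le_of_succ_le h) w s).run fun i => (S i, f (S i))).toOuterMeasure E :=
      fun w s => G.measurable_run hf E m _ w s
    have hterm : ∀ r₁ r₂, Measurable fun S : Fin n → X => ENNReal.ofReal
        (respProb G.c (G.pointGrad w (S ⟨m, h⟩, f (S ⟨m, h⟩))) r₁ *
          respProb G.c (G.labelGrad (S ⟨m, h⟩, f (S ⟨m, h⟩))) r₂) *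
        ((G.prog m (Nat.le_of_succ_le h) (G.step w r₁ r₂) (s + w)).run
          fun i => (S i, f (S i))).toOuterMeasure E := fun r₁ r₂ =>
      ((hpm r₁ r₂).comp (measurable_pi_apply _)).mul (hqm _ _)
    -- The responses of this step depend on the example `m` only, and the later steps do not.
    simp only [run_succ]
    rw [lintegral_finsetSum _ fun r₁ _ => Finset.measurable_fun_sum _ fun r₂ _ => hterm r₁ r₂]
    calc _ = ∑ r₁, ∑ r₂, (∫⁻ x, ENNReal.ofReal (respProb G.c (G.pointGrad w (x, f x)) r₁ *
            respProb G.c (G.labelGrad (x, f x)) r₂) ∂D) *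
          ∫⁻ S : Fin n → X, ((G.prog m (Nat.le_of_succ_le h) (G.step w r₁ r₂) (s + w)).run
            fun i => (S i, f (S i))).toOuterMeasure E ∂(Measure.pi fun _ => D) := by
          refine sum_congr rfl fun r₁ _ => ?_
          rw [lintegral_finsetSum _ fun r₂ _ => hterm r₁ r₂]
          exact sum_congr rfl fun r₂ _ => lintegral_pi_mul D ⟨m, h⟩ (hpm r₁ r₂) (hqm _ _)
            fun S x => G.run_update f E ⟨m, h⟩ x S m _ le_rfl _ _
      _ ≤ ∑ r₁, ∑ r₂, ENNReal.ofReal ((∫ x, respProb G.c (G.pointGrad w (x, f x)) r₁ *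
            respProb G.c (G.labelGrad (x, f x)) r₂ ∂D) * ((n * G.γ * α)⁻¹ *
              G.potential D f u (t + 1) m (G.step w r₁ r₂) (s + w))) := by
          refine sum_le_sum fun r₁ _ => sum_le_sum fun r₂ _ => ?_
          rw [ENNReal.ofReal_mul (integral_nonneg (hp0 r₁ r₂)),
            ofReal_integral_eq_lintegral_ofReal (G.integrable_respProb_mul D hf w r₁ r₂)
              (ae_of_all _ (hp0 r₁ r₂))]
          exact mul_le_mul_right (ih _ _) _
      _ = ENNReal.ofReal ((n * G.γ * α)⁻¹ * ∑ r₁, ∑ r₂,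
            (∫ x, respProb G.c (G.pointGrad w (x, f x)) r₁ *
              respProb G.c (G.labelGrad (x, f x)) r₂ ∂D) *
              G.potential D f u (t + 1) m (G.step w r₁ r₂) (s + w)) := by
          have hnn : ∀ r₁ r₂, 0 ≤ (∫ x, respProb G.c (G.pointGrad w (x, f x)) r₁ *
              respProb G.c (G.labelGrad (x, f x)) r₂ ∂D) * ((n * G.γ * α)⁻¹ *
                G.potential D f u (t + 1) m (G.step w r₁ r₂) (s + w)) := fun r₁ r₂ =>
            mul_nonneg (integral_nonneg (hp0 r₁ r₂))
              (mul_nonneg (by positivity) (G.potential_nonneg D f u _ _ _ _))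
          rw [mul_sum, ENNReal.ofReal_sum_of_nonneg fun r₁ _ => mul_nonneg (by positivity)
            (sum_nonneg fun r₂ _ => ?_)]
          · refine sum_congr rfl fun r₁ _ => ?_
            rw [mul_sum, ENNReal.ofReal_sum_of_nonneg fun r₂ _ => ?_]
            · refine sum_congr rfl fun r₂ _ => ?_
              congr 1
              ring
            · have := hnn r₁ r₂
              rwa [mul_left_comm] at this
          · exact mul_nonneg (integral_nonneg (hp0 r₁ r₂)) (G.potential_nonneg D f u _ _ _ _)
      _ ≤ _ := ENNReal.ofReal_le_ofReal (mul_le_mul_of_nonneg_left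
          (G.sum_integral_mul_potential_le D hf u t m w s) (by positivity))

end SGD

/-! ### The learner -/

theorem measurable_clip (B : ℝ) : Measurable (clip B) :=
  measurable_const.max (measurable_const.min measurable_id)

/-- The descent on the truncated random features `x ↦ clip B ⟨r j, Ψ x⟩ / B`, for given sign
vectors `r j`. -/
abbrev featureSGD {X : Type*} [MeasurableSpace X] {d : ℕ} {Ψ : X → EuclideanSpace ℝ (Fin d)}
    (hΨ : Measurable Ψ) {k : ℕ} (hk : 0 < k) {B : ℝ} (hB : 0 < B) {η c γ τ : ℝ} (hη0 : 0 ≤ η)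
    (hη1 : η ≤ 1) (hc0 : 0 < c) (hc : c ≤ η / 3) (hγ : 0 < γ) (hτ : 0 < τ)
    (r : Fin k → Fin d → Bool) : SGD X where
  k := k
  k_pos := hk
  φ x j := clip B (rad (Ψ x) (r j)) / B
  measurable_φ := by
    refine measurable_pi_lambda _ fun j => Measurable.div_const ((measurable_clip B).comp ?_) B
    unfold rad
    fun_prop
  abs_φ_le x j := by
    rw [abs_div, abs_of_pos hB, div_le_one hB]
    exact abs_clip_le hB.le _
  η := η
  η_nonneg := hη0
  η_le := hη1
  c := c
  c_pos := hc0
  c_le := hc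
  γ := γ
  γ_pos := hγ
  τ := τ
  τ_pos := hτ

section Learner

variable {X : Type*} [MeasurableSpace X] {d : ℕ} {Ψ : X → EuclideanSpace ℝ (Fin d)}
  (hΨ : Measurable Ψ) {k : ℕ} (hk : 0 < k) {B : ℝ} (hB : 0 < B) {η c γ τ : ℝ} (hη0 : 0 ≤ η)
  (hη1 : η ≤ 1) (hc0 : 0 < c) (hc : c ≤ η / 3) (hγ : 0 < γ) (hτ : 0 < τ)

/-- The learner that draws `k` uniformly random sign vectors and runs the gradient descent on the
corresponding features, for `n` steps from the origin. -/
def learner (n : ℕ) : Learner X n :=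
  (PMF.uniformOfFintype (Fin k → Fin d → Bool)).map fun r =>
    (featureSGD hΨ hk hB hη0 hη1 hc0 hc hγ hτ r).prog n le_rfl 0 0

theorem isLDP_learner (n : ℕ) {ε : ℝ} (hε : 2 * η ≤ ε) :
    (learner hΨ hk hB hη0 hη1 hc0 hc hγ hτ n).IsLDP ε := by
  intro p hp L hL i
  obtain ⟨r, -, rfl⟩ := (PMF.mem_support_map_iff _ _ _).1 hp
  exact ((featureSGD hΨ hk hB hη0 hη1 hc0 hc hγ hτ r).isLDP_prog n le_rfl 0 0 L hL i).trans hε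

theorem labelNonAdaptive_learner (n : ℕ) :
    (learner hΨ hk hB hη0 hη1 hc0 hc hγ hτ n).LabelNonAdaptive := by
  intro p hp
  obtain ⟨r, -, rfl⟩ := (PMF.mem_support_map_iff _ _ _).1 hp
  exact (featureSGD hΨ hk hB hη0 hη1 hc0 hc hγ hτ r).labelNonAdaptive_prog le_rfl 0 0

/-- The predictor `(B / k) ⟨r j, w⟩` that imitates the weight vector `w` on the features given by
`r`. -/
def comparator (B : ℝ) (w : EuclideanSpace ℝ (Fin d)) (r : Fin k → Fin d → Bool) (j : Fin k) : ℝ :=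
  B / k * rad w (r j)

theorem sum_sq_le_one {w : EuclideanSpace ℝ (Fin d)} (hw : ‖w‖ ≤ 1) : ∑ i, w i ^ 2 ≤ 1 := by
  have h := EuclideanSpace.real_norm_sq_eq w
  rw [← h]
  exact pow_le_one₀ (norm_nonneg _) hw

/-- The initial potential, averaged over the random features. -/
theorem expect_potential_le (hΨ1 : ∀ x, ‖Ψ x‖ ≤ 1) (D : Measure X) [IsProbabilityMeasure D]
    {f : X → Bool} (hf : Measurable f) {w : EuclideanSpace ℝ (Fin d)} (hw1 : ‖w‖ ≤ 1)
    (hw : ∀ x, γ ≤ sgn (f x) * inner ℝ w (Ψ x)) {δ : ℝ} (hδ : 0 < δ) (n : ℕ) :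
    𝔼 r, (featureSGD hΨ hk hB hη0 hη1 hc0 hc hγ hτ r).potential D f (comparator B w r) 0 n 0 0 ≤
      B ^ 2 / k / (2 * τ) +
        n * (2 * (2 / B + (B ^ 2 / k / (2 * δ) + δ / 2)) + 2 * τ * (k / c) ^ 2) := by
  set G := featureSGD hΨ hk hB hη0 hη1 hc0 hc hγ hτ with hG
  have hk' : (0 : ℝ) < k := by exact_mod_cast hk
  have hnorm : 𝔼 r : Fin k → Fin d → Bool, ∑ j, (0 - comparator B w r j) ^ 2 ≤ B ^ 2 / k := by
    have e : ∀ r : Fin k → Fin d → Bool, ∑ j, (0 - comparator B w r j) ^ 2 =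
        (B / k) ^ 2 * ∑ j, rad w (r j) ^ 2 := by
      intro r
      rw [mul_sum]
      refine sum_congr rfl fun j _ => ?_
      rw [comparator]
      ring
    simp only [e]
    rw [← mul_expect, expect_sum_coord k fun s => rad w s ^ 2, expect_rad_sq]
    calc _ ≤ (B / k) ^ 2 * (k * 1) := by
          gcongr
          exact sum_sq_le_one hw1
      _ = _ := by field_simp
  have hpoint : ∀ x, 𝔼 r, loss γ (sgn (f x)) (pred (G r).φ (comparator B w r) x) ≤
      2 * (2 / B + (B ^ 2 / k / (2 * δ) + δ / 2)) := by
    intro x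
    have h := expect_abs_projection_sub_le hk (sum_sq_le_one (hΨ1 x)) (sum_sq_le_one hw1) hB hδ
    refine le_trans ?_ (mul_le_mul_of_nonneg_left h zero_le_two)
    rw [mul_expect]
    refine expect_le_expect fun r _ => ?_
    have hin : inner ℝ w (Ψ x) = ∑ i, w i * Ψ x i := by
      rw [PiLp.inner_apply]
      exact sum_congr rfl fun i _ => by simp [mul_comm]
    have hpred : pred (G r).φ (comparator B w r) x =
        (∑ j, rad w (r j) * clip B (rad (Ψ x) (r j))) / k := by
      rw [sum_div]
      refine sum_congr rfl fun j _ => ?_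
      change B / k * rad w (r j) * (clip B (rad (Ψ x) (r j)) / B) = _
      field_simp
    rw [hpred, ← hin]
    exact loss_le_of_margin hγ (abs_sgn _) (hw x) _
  have hrisk : 𝔼 r, (G r).risk D f γ (comparator B w r) ≤
      2 * (2 / B + (B ^ 2 / k / (2 * δ) + δ / 2)) := by
    have hinteg : ∀ r, Integrable
        (fun x => loss γ (sgn (f x)) (pred (G r).φ (comparator B w r) x)) D :=
      fun r => (G r).integrable_loss D hf γ _
    have e : 𝔼 r, (G r).risk D f γ (comparator B w r) =
        ∫ x, 𝔼 r, loss γ (sgn (f x)) (pred (G r).φ (comparator B w r) x) ∂D := by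
      simp only [Fintype.expect_eq_sum_div_card]
      rw [integral_div, integral_finsetSum _ fun r _ => hinteg r]
      rfl
    rw [e]
    calc _ ≤ ∫ _, 2 * (2 / B + (B ^ 2 / k / (2 * δ) + δ / 2)) ∂D := by
          refine integral_mono ?_ (integrable_const _) hpoint
          simp only [Fintype.expect_eq_sum_div_card]
          exact (integrable_finsetSum _ fun r _ => hinteg r).div_const _
      _ = _ := by simp
  have hzero : ∀ r, (G r).risk D f ((G r).γ * (0 : ℕ)) 0 = 0 := by
    intro r
    simp [SGD.risk, loss, pred]
  have hpot : ∀ r, (G r).potential D f (comparator B w r) 0 n 0 0 =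
      (∑ j, (0 - comparator B w r j) ^ 2) / (2 * τ) +
        n * ((G r).risk D f γ (comparator B w r) + 2 * τ * (k / c) ^ 2) := by
    intro r
    rw [SGD.potential, hzero, zero_add]
    rfl
  rw [expect_congr rfl fun r _ => hpot r]
  simp only [expect_add_distrib, ← mul_expect, ← expect_div, Fintype.expect_const]
  gcongr

theorem run_learner {n : ℕ} (S : Fin n → X × Bool) (E : Set (X → Bool)) :
    ((learner hΨ hk hB hη0 hη1 hc0 hc hγ hτ n).run S).toOuterMeasure E =
      ∑ r, (Fintype.card (Fin k → Fin d → Bool) : ℝ≥0∞)⁻¹ *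
        (((featureSGD hΨ hk hB hη0 hη1 hc0 hc hγ hτ r).prog n le_rfl 0 0).run S).toOuterMeasure
          E := by
  rw [Learner.run, learner, PMF.bind_map, PMF.toOuterMeasure_bind_apply, tsum_fintype]
  simp only [PMF.uniformOfFintype_apply, Function.comp_apply]

theorem measurable_run_learner {f : X → Bool} (hf : Measurable f) {n : ℕ} (E : Set (X → Bool)) :
    Measurable fun S : Fin n → X => ((learner hΨ hk hB hη0 hη1 hc0 hc hγ hτ n).run
        fun i => (S i, f (S i))).toOuterMeasure E := by
  simp only [run_learner]
  exact Finset.measurable_fun_sum _ fun r _ =>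
    ((featureSGD hΨ hk hB hη0 hη1 hc0 hc hγ hτ r).measurable_run hf E n le_rfl 0 0).const_mul _

theorem lintegral_run_learner_le (D : Measure X) [IsProbabilityMeasure D] {f : X → Bool}
    (hf : Measurable f) (w : EuclideanSpace ℝ (Fin d)) {α : ℝ} (hα : 0 < α) {n : ℕ} (hn : 0 < n) :
    ∫⁻ S : Fin n → X, ((learner hΨ hk hB hη0 hη1 hc0 hc hγ hτ n).run
        fun i => (S i, f (S i))).toOuterMeasure
          {g | D {z | f z ≠ g z} ≤ ENNReal.ofReal α}ᶜ ∂(Measure.pi fun _ => D) ≤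
      ENNReal.ofReal ((n * γ * α)⁻¹ * 𝔼 r, (featureSGD hΨ hk hB hη0 hη1 hc0 hc hγ hτ r).potential
        D f (comparator B w r) 0 n 0 0) := by
  have hm := fun r => (featureSGD hΨ hk hB hη0 hη1 hc0 hc hγ hτ r).measurable_run hf
    {g | D {z | f z ≠ g z} ≤ ENNReal.ofReal α}ᶜ n le_rfl 0 0
  have hle := fun r => (featureSGD hΨ hk hB hη0 hη1 hc0 hc hγ hτ r).lintegral_run_le D hf
    (comparator B w r) hα hn n le_rfl 0 (zero_add n) 0 0
  have hnn := fun r => (featureSGD hΨ hk hB hη0 hη1 hc0 hc hγ hτ r).potential_nonneg D f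
    (comparator B w r) 0 n 0 0
  have hcard : (0 : ℝ) < Fintype.card (Fin k → Fin d → Bool) := by exact_mod_cast Fintype.card_pos
  simp only [run_learner]
  rw [lintegral_finsetSum _ fun r _ => (hm r).const_mul _, Fintype.expect_eq_sum_div_card,
    div_eq_inv_mul, mul_left_comm, mul_sum, ENNReal.ofReal_mul (by positivity),
    ENNReal.ofReal_sum_of_nonneg fun r _ => mul_nonneg (by positivity) (hnn r), mul_sum,
    ENNReal.ofReal_inv_of_pos hcard, ENNReal.ofReal_natCast]
  refine sum_le_sum fun r _ => ?_
  rw [lintegral_const_mul _ (hm r)]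
  exact mul_le_mul_right (hle r) _

end Learner

/-- It suffices that the hypothesis is bad with probability at most `1 / 3`. -/
theorem two_thirds_le_lintegral {X : Type*} [MeasurableSpace X] {n : ℕ} (A : Learner X n)
    (D : Measure X) [IsProbabilityMeasure D] (f : X → Bool) (E : Set (X → Bool))
    (hm : Measurable fun S : Fin n → X => (A.run fun i => (S i, f (S i))).toOuterMeasure Eᶜ)
    (h : ∫⁻ S : Fin n → X, (A.run fun i => (S i, f (S i))).toOuterMeasure Eᶜ
      ∂(Measure.pi fun _ => D) ≤ 1 / 3) :
    2 / 3 ≤ ∫⁻ S : Fin n → X, (A.run fun i => (S i, f (S i))).toOuterMeasure E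
      ∂(Measure.pi fun _ => D) := by
  have hone : ∀ p : PMF (X → Bool), 1 ≤ p.toOuterMeasure E + p.toOuterMeasure Eᶜ := by
    intro p
    have h1 : p.toOuterMeasure Set.univ = 1 :=
      (PMF.toOuterMeasure_apply_eq_one_iff _ _).2 (Set.subset_univ _)
    rw [← h1, ← Set.union_compl_self E]
    exact measure_union_le _ _
  have htot : 1 ≤ (∫⁻ S : Fin n → X, (A.run fun i => (S i, f (S i))).toOuterMeasure E
      ∂(Measure.pi fun _ => D)) + 1 / 3 := by
    calc (1 : ℝ≥0∞) = ∫⁻ _ : Fin n → X, 1 ∂(Measure.pi fun _ => D) := by simp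
      _ ≤ ∫⁻ S : Fin n → X, ((A.run fun i => (S i, f (S i))).toOuterMeasure E +
          (A.run fun i => (S i, f (S i))).toOuterMeasure Eᶜ) ∂(Measure.pi fun _ => D) :=
          lintegral_mono fun S => hone _
      _ ≤ _ := by
          rw [lintegral_add_right _ hm]
          gcongr
  have e : (2 / 3 : ℝ≥0∞) + 1 / 3 = 1 := by
    rw [ENNReal.div_add_div_same]
    norm_num
    exact ENNReal.div_self (by norm_num) (by norm_num)
  exact (ENNReal.add_le_add_iff_right (by simp)).1 (e.le.trans htot)

/-- With `θ = 1 / N ≤ α / M` and `1 / N ≤ min ε 1`, take the truncation level `B = 60 / θ`, the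
number of features `k = 810000 / θ ^ 4`, the response bias `c = 1 / (6 N)`, and the step size
`τ = θ c ^ 2 / (30 k ^ 2)`. With `δ = θ / 15`, each of the five terms of the bound
`expect_potential_le`, divided by the number `n` of steps, is then at most `θ / 15`: the terms
`4 / B`, `B ^ 2 / (k δ)` and `δ` come from the random features, `2 τ (k / c) ^ 2` from the noise,
and `B ^ 2 / (2 τ k n)`, which fixes `n`, from the distance to the comparator. Hence a bad hypothesis
has probability at most `5 / 15`. -/
theorem exists_learner {X : Type*} [MeasurableSpace X] {C : Set (X → Bool)}
    (hC : ∀ f ∈ C, Measurable f) {M α ε : ℝ} (hM : 0 < M) (hsep : SeparableWith C M) (hα : 0 < α)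
    (hε : 0 < ε) {N : ℕ} (hN0 : 0 < N) (hNM : M / α ≤ N) (hNε : 1 / min ε 1 ≤ N) :
    ∃ A : Learner X (225 * 3600 * 810000 * 36 * N ^ 10),
      A.IsLDP ε ∧ A.LabelNonAdaptive ∧ A.PACLearns C α := by
  obtain ⟨d, Ψ, hΨ, hΨ1, hw⟩ := hsep.exists_measurable hM hC
  have hN : (0 : ℝ) < N := by exact_mod_cast hN0
  have hε1 : 0 < min ε 1 := lt_min hε one_pos
  have hk : 0 < 810000 * N ^ 4 := by positivity
  have hB : (0 : ℝ) < 60 * N := by positivity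
  have hc0 : (0 : ℝ) < 1 / (6 * N) := by positivity
  have hc : 1 / (6 * (N : ℝ)) ≤ min ε 1 / 2 / 3 := by
    have : 1 / (N : ℝ) ≤ min ε 1 := by
      rw [div_le_iff₀ hε1] at hNε
      rw [div_le_iff₀ hN]
      linarith
    calc 1 / (6 * (N : ℝ)) = 1 / N / 6 := by field_simp
      _ ≤ min ε 1 / 6 := by gcongr
      _ = _ := by ring
  have hτ : (0 : ℝ) < (1 / (6 * N)) ^ 2 / (30 * N * (810000 * N ^ 4 : ℕ) ^ 2) := by positivity
  have hη1 : min ε 1 / 2 ≤ 1 := by linarith [min_le_right ε 1]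
  refine ⟨learner hΨ hk hB (half_pos hε1).le hη1 hc0 hc (one_div_pos.2 hM) hτ _,
    isLDP_learner hΨ hk hB _ hη1 hc0 hc _ hτ _ (by linarith [min_le_left ε 1]),
    labelNonAdaptive_learner hΨ hk hB _ hη1 hc0 hc _ hτ _, ?_⟩
  intro f hf D _
  refine two_thirds_le_lintegral _ D f _ (measurable_run_learner hΨ hk hB _ hη1 hc0 hc _ hτ
    (hC f hf) _) ?_
  obtain ⟨w, hw1, hwx⟩ := hw f hf
  have hn : 0 < 225 * 3600 * 810000 * 36 * N ^ 10 := by positivity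
  refine (lintegral_run_learner_le hΨ hk hB _ hη1 hc0 hc _ hτ D (hC f hf) w hα hn).trans ?_
  have hpot := expect_potential_le hΨ hk hB (half_pos hε1).le hη1 hc0 hc (one_div_pos.2 hM) hτ
    hΨ1 D (hC f hf) hw1 hwx (δ := 1 / (15 * N)) (by positivity) (225 * 3600 * 810000 * 36 * N ^ 10)
  have e3 : (1 / 3 : ℝ≥0∞) = ENNReal.ofReal (1 / 3) := by
    rw [ENNReal.ofReal_div_of_pos (by norm_num)]
    simp
  rw [e3]
  refine ENNReal.ofReal_le_ofReal ?_
  refine (mul_le_mul_of_nonneg_left hpot (by positivity)).trans ?_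
  push_cast
  calc _ = M / α * (1 / (3 * N)) := by
        field_simp
        norm_num
    _ ≤ N * (1 / (3 * N)) := by gcongr
    _ = _ := by field_simp

/-- A nonempty class on a nonempty domain has margin complexity at least `1`. -/
theorem one_le_marginComplexity {X : Type*} [Nonempty X] {C : Set (X → Bool)} (hC : C.Nonempty) :
    1 ≤ marginComplexity C := by
  obtain ⟨f, hf⟩ := hC
  obtain ⟨x⟩ := ‹Nonempty X›
  refine le_iInf₂ fun M hM => ?_
  obtain ⟨hM0, d, Ψ, hΨ, hw⟩ := hM
  obtain ⟨w, hw1, hwx⟩ := hw f hf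
  rw [ENNReal.one_le_ofReal]
  have h : 1 / M ≤ 1 := by
    calc 1 / M ≤ sgn (f x) * inner ℝ w (Ψ x) := hwx x
      _ ≤ |sgn (f x) * inner ℝ w (Ψ x)| := le_abs_self _
      _ = |inner ℝ w (Ψ x)| := by rw [abs_mul, abs_sgn, one_mul]
      _ ≤ ‖w‖ * ‖Ψ x‖ := abs_real_inner_le_norm _ _
      _ ≤ 1 := mul_le_one₀ hw1 (norm_nonneg _) (hΨ x)
  rwa [div_le_one hM0] at h

end

end LDP

theorem theorem2 :
    ∃ P : Polynomial ℝ,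
      ∀ (X : Type*) [MeasurableSpace X] (C : Set (X → Bool)),
        (∀ f ∈ C, Measurable f) →
        LDP.marginComplexity C ≠ ⊤ →
        ∀ α ε : ℝ, 0 < α → 0 < ε →
          ∃ (n : ℕ) (A : LDP.Learner X n),
            (n : ℝ) ≤ P.eval ((LDP.marginComplexity C).toReal / (α * min ε 1)) ∧
            A.IsLDP ε ∧ A.LabelNonAdaptive ∧ A.PACLearns C α := by
  -- The sample size below is `225 * 3600 * 810000 * 36 * N ^ 10` with `N = ⌈2 x⌉ ≤ 3 x`.
  refine ⟨Polynomial.C (225 * 3600 * 810000 * 36 * 3 ^ 10) * Polynomial.X ^ 10, ?_⟩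
  intro X _ C hC hmc α ε hα hε
  have hε1 : 0 < min ε 1 := lt_min hε one_pos
  simp only [Polynomial.eval_mul, Polynomial.eval_C, Polynomial.eval_pow, Polynomial.eval_X]
  by_cases htriv : C.Nonempty ∧ Nonempty X ∧ α < 1
  · obtain ⟨hCne, hX, hα1⟩ := htriv
    have h1 := LDP.one_le_marginComplexity hCne
    set μ := (LDP.marginComplexity C).toReal with hμ
    have hμ1 : 1 ≤ μ := by
      rw [hμ, ← ENNReal.toReal_one]
      exact ENNReal.toReal_mono hmc h1
    have hlt : LDP.marginComplexity C < ENNReal.ofReal (2 * μ) := by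
      rw [← ENNReal.ofReal_toReal hmc]
      exact (ENNReal.ofReal_lt_ofReal_iff (by linarith)).2 (by linarith)
    -- The infimum in the margin complexity need not be attained, so `M ≤ 2 μ` is used.
    obtain ⟨M, hM⟩ := iInf_lt_iff.1 hlt
    obtain ⟨⟨hM0, hsep⟩, hMlt⟩ := iInf_lt_iff.1 hM
    have hMle : M ≤ 2 * μ := ((ENNReal.ofReal_lt_ofReal_iff (by linarith)).1 hMlt).le
    have hm1 : min ε 1 ≤ 1 := min_le_right _ _
    set x := μ / (α * min ε 1) with hx
    have hx1 : 1 ≤ x := by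
      rw [hx, one_le_div (by positivity)]
      nlinarith
    have hN : 2 * x ≤ (⌈2 * x⌉₊ : ℝ) := Nat.le_ceil _
    have hN0 : 0 < ⌈2 * x⌉₊ := Nat.ceil_pos.2 (by linarith)
    have hN3 : (⌈2 * x⌉₊ : ℝ) ≤ 3 * x := by
      have := Nat.ceil_lt_add_one (show 0 ≤ 2 * x by linarith)
      linarith
    have hNM : M / α ≤ (⌈2 * x⌉₊ : ℝ) := by
      refine le_trans ?_ hN
      rw [hx, div_le_iff₀ hα]
      have e : 2 * (μ / (α * min ε 1)) * α = 2 * μ / min ε 1 := by field_simp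
      rw [e, le_div_iff₀ hε1]
      nlinarith
    have hNε : 1 / min ε 1 ≤ (⌈2 * x⌉₊ : ℝ) := by
      refine le_trans ?_ hN
      rw [hx, div_le_iff₀ hε1]
      have e : 2 * (μ / (α * min ε 1)) * min ε 1 = 2 * μ / α := by field_simp
      rw [e, le_div_iff₀ hα]
      linarith
    obtain ⟨A, hA⟩ := LDP.exists_learner hC hM0 hsep hα hε hN0 hNM hNε
    refine ⟨_, A, ?_, hA⟩
    push_cast
    calc _ ≤ 225 * 3600 * 810000 * 36 * (3 * x) ^ 10 := by
          gcongr
          norm_num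
      _ = _ := by ring
  · -- If `1 ≤ α`, every hypothesis is good enough; otherwise there is nothing to learn.
    refine ⟨0, PMF.pure (.output fun _ => true), ?_, ?_, ?_, ?_⟩
    · rw [Nat.cast_zero]
      positivity
    · intro p hp L hL i
      exact i.elim0
    · intro p hp
      rw [PMF.mem_support_pure_iff] at hp
      subst hp
      exact ⟨[], fun L hL => by cases hL; rfl⟩
    · intro f hf D _
      have hα1 : 1 ≤ α := by
        by_contra hlt
        exact htriv ⟨⟨f, hf⟩, MeasureTheory.nonempty_of_isProbabilityMeasure D, not_le.1 hlt⟩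
      have huniv : {g : X → Bool | D {z | f z ≠ g z} ≤ ENNReal.ofReal α} = Set.univ :=
        Set.eq_univ_of_forall fun g =>
          MeasureTheory.prob_le_one.trans (ENNReal.one_le_ofReal.2 hα1)
      rw [huniv]
      refine LDP.two_thirds_le_lintegral _ D f _ ?_ ?_ <;> simp
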